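/- **Notation.** Write $\mathbb R^+=(0,\infty)$, $\mathbb R^-=(-\infty,0)$ and $X_0^\pm = L^1(\mathbb R^\pm)\cap L^2(\mathbb R^\pm)$; all functions and distributions are real-valued. Let $\mathcal Q$ be the set of all distributions $q\in H^{-1}(\mathbb R)$ for which there are $u_+\in L^2(\mathbb R)\cap L^1(\mathbb R^+)$ and $u_-\in L^2(\mathbb R)\cap L^1(\mathbb R^-)$ with $q=u_+'+u_+^2=u_-'+u_-^2$ in the sense of distributions. For $q\in H^{-1}(\mathbb R)$ let $\mathrm{Pos}(q)$ be the set of all $y\in H^1_{\mathrm{loc}}(\mathbb R)$ such that $y>0$, $y(0)=1$ and $$\int_{\mathbb R}\varphi' y'\,dx+\langle q,\varphi y\rangle=0\qquad\text{for all }\varphi\in C_0^\infty(\mathbb R),$$ where $\langle\cdot,\cdot\rangle$ is the dual pairing of $H^{-1}(\mathbb R)$ and $H^1(\mathbb R)$. The extremal elements $y_\pm$ of $\mathrm{Pos}(q)$ are characterized by $$\int_0^\infty \frac{ds}{y_+^2(s)}=+\infty,\qquad \int_{-\infty}^0\frac{ds}{y_-^2(s)}=+\infty ,$$ and $u_\pm=y_\pm'/y_\pm$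 are called the extremal Riccati representatives of $q$. Set $v=u_--u_+$. **Lemma 2.3.** (a) Let $w_+\in X_0^+$ and $w_-\in X_0^-$ be real-valued and let $\alpha\ge 0$. Then there is a unique distribution $q\in\mathcal Q$ whose extremal Riccati representatives $u_\pm$ and $v=u_--u_+$ (taken as its continuous representative) satisfy $$(u_+|_{\mathbb R^+},\,u_-|_{\mathbb R^-},\,v(0))=(w_+,w_-,\alpha).$$ (b) Conversely, for every $q\in\mathcal Q$ the extremal Riccati representatives $u_\pm$ exist and are unique (up to null sets), $v=u_--u_+$ has a continuous representative, and $u_+|_{\mathbb R^+}\in X_0^+$, $u_-|_{\mathbb R^-}\in X_0^-$, $v(0)\ge 0$. Hence $q\mapsto(u_+|_{\mathbb R^+},u_-|_{\mathbb R^-},v(0))$ is a bijection from $\mathcal Q$ onto $X_0^+\times X_0^-\times[0,\infty)$, i.e. these data are independent coordinates on $\mathcal Q$. -/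

import Mathlib

open MeasureTheory Set Filter Topology TopologicalSpace
open scoped Distributions LineDeriv ENNReal NNReal

namespace MiuraPotential

/-- Real test functions `C₀^∞(ℝ)`. -/
abbrev TestFun : Type := 𝓓((⊤ : Opens ℝ), ℝ)

/-- Real-valued distributions on the line. -/
abbrev Distr : Type := 𝓓'((⊤ : Opens ℝ), ℝ)

/-- The regular distribution `φ ↦ ∫ φ f` attached to a locally integrable function `f`
(the junk value is `0` if `f` is not locally integrable). -/
noncomputable def regular (f : ℝ → ℝ) : Distr :=
  TestFunction.integralAgainstBilinCLM (ContinuousLinearMap.mul ℝ ℝ) volume f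

/-- `g` is the weak (distributional) derivative of `f`. -/
def IsWeakDeriv (f g : ℝ → ℝ) : Prop :=
  LocallyIntegrable f ∧ LocallyIntegrable g ∧ ∂_{(1 : ℝ)} (regular f) = regular g

/-- The `H¹(ℝ)`-norm `‖f‖_{L²} + ‖f'‖_{L²}` (equivalent to the Hilbert norm), with value `∞` if `f`
has no weak derivative. The weak derivative is unique up to null sets, so the infimum is taken over
a single value. -/
noncomputable def h1Norm (f : ℝ → ℝ) : ℝ≥0∞ :=
  ⨅ (g : ℝ → ℝ) (_ : IsWeakDeriv f g), (eLpNorm f 2 volume + eLpNorm g 2 volume)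

/-- `q ∈ H⁻¹(ℝ)`, the dual of `H¹(ℝ)`: the distribution `q` is bounded on test functions with
respect to the `H¹`-norm. -/
def MemHNegOne (q : Distr) : Prop :=
  ∃ C : ℝ≥0, ∀ φ : TestFun, ‖q φ‖ₑ ≤ C * h1Norm φ

/-- The dual pairing `⟨q, ψ⟩` of `q ∈ H⁻¹(ℝ)` with `ψ ∈ H¹(ℝ)`: the extension of `q` by
continuity from test functions, i.e. the limit of `q χ` as the test function `χ` tends to `ψ`
in the `H¹`-norm. -/
noncomputable def dualPairing (q : Distr) (ψ : ℝ → ℝ) : ℝ :=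
  limUnder (comap (fun χ : TestFun => h1Norm (fun x => χ x - ψ x)) (𝓝 0)) (fun χ => q χ)

/-- `f ∈ L²_loc(ℝ)`. -/
def MemL2Loc (f : ℝ → ℝ) : Prop :=
  ∀ K : Set ℝ, IsCompact K → MemLp f 2 (volume.restrict K)

/-- `y ∈ H¹_loc(ℝ)` (given by its continuous representative), with weak derivative `y'`. -/
def MemH1Loc (y y' : ℝ → ℝ) : Prop :=
  Continuous y ∧ IsWeakDeriv y y' ∧ MemL2Loc y'

/-- The form `𝔰(φ, y) = ∫ φ' y' + ⟨q, φ y⟩` for a test function `φ` and for `y ∈ H¹_loc(ℝ)` with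
weak derivative `y'`. -/
noncomputable def form (q : Distr) (φ : TestFun) (y y' : ℝ → ℝ) : ℝ :=
  (∫ x, deriv φ x * y' x) + dualPairing q (fun x => φ x * y x)

/-- `y ∈ Pos(q)`, with weak derivative `y'`: a positive solution `y ∈ H¹_loc(ℝ)` of
`-y'' + q y = 0` normalized by `y 0 = 1`. -/
structure IsPos (q : Distr) (y y' : ℝ → ℝ) : Prop where
  memH1Loc : MemH1Loc y y'
  normalized : y 0 = 1
  pos : ∀ x, 0 < y x
  solution : ∀ φ : TestFun, form q φ y y' = 0

/-- `u = u₊ = y₊' / y₊`, where `y₊ ∈ Pos(q)` is extremal at `+∞`: `∫_0^∞ y₊⁻² = ∞`. -/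
def IsRightExtremalRep (q : Distr) (u : ℝ → ℝ) : Prop :=
  ∃ y y' : ℝ → ℝ, IsPos q y y' ∧ (∫⁻ s in Ioi 0, ENNReal.ofReal (1 / y s ^ 2)) = ∞ ∧
    u =ᵐ[volume] fun x => y' x / y x

/-- `u = u₋ = y₋' / y₋`, where `y₋ ∈ Pos(q)` is extremal at `-∞`: `∫_{-∞}^0 y₋⁻² = ∞`. -/
def IsLeftExtremalRep (q : Distr) (u : ℝ → ℝ) : Prop :=
  ∃ y y' : ℝ → ℝ, IsPos q y y' ∧ (∫⁻ s in Iio 0, ENNReal.ofReal (1 / y s ^ 2)) = ∞ ∧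
    u =ᵐ[volume] fun x => y' x / y x

/-- The Miura map `u ↦ u' + u²` from `L²_loc(ℝ)` to distributions. -/
noncomputable def miura (u : ℝ → ℝ) : Distr :=
  ∂_{(1 : ℝ)} (regular u) + regular (fun x => u x ^ 2)

/-- The class `𝒬`: real `q ∈ H⁻¹(ℝ)` such that `q = u₊' + u₊² = u₋' + u₋²` for some
`u₊ ∈ L²(ℝ) ∩ L¹(ℝ⁺)` and `u₋ ∈ L²(ℝ) ∩ L¹(ℝ⁻)`. -/
def classQ : Set Distr :=
  {q | MemHNegOne q ∧ ∃ uPlus uMinus : ℝ → ℝ,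
    (MemLp uPlus 2 volume ∧ IntegrableOn uPlus (Ioi 0)) ∧
    (MemLp uMinus 2 volume ∧ IntegrableOn uMinus (Iio 0)) ∧
    q = miura uPlus ∧ q = miura uMinus}

/-- `w ∈ X₀⁺ = L¹(0, ∞) ∩ L²(0, ∞)`, real-valued (only the values on `(0, ∞)` matter). -/
def MemX0Plus (w : ℝ → ℝ) : Prop :=
  MemLp w 1 (volume.restrict (Ioi 0)) ∧ MemLp w 2 (volume.restrict (Ioi 0))

/-- `w ∈ X₀⁻ = L¹(-∞, 0) ∩ L²(-∞, 0)`, real-valued (only the values on `(-∞, 0)` matter). -/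
def MemX0Minus (w : ℝ → ℝ) : Prop :=
  MemLp w 1 (volume.restrict (Iio 0)) ∧ MemLp w 2 (volume.restrict (Iio 0))

/-- The extremal Riccati representatives `u₊, u₋` of `q` and the continuous representative `v` of
`u₋ - u₊` satisfy `(u₊|_{ℝ⁺}, u₋|_{ℝ⁻}, v 0) = (w₊, w₋, α)`. -/
def HasExtremalData (q : Distr) (wPlus wMinus : ℝ → ℝ) (α : ℝ) : Prop :=
  ∃ uPlus uMinus v : ℝ → ℝ, IsRightExtremalRep q uPlus ∧ IsLeftExtremalRep q uMinus ∧
    Continuous v ∧ (v =ᵐ[volume] fun x => uMinus x - uPlus x) ∧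
    uPlus =ᵐ[volume.restrict (Ioi 0)] wPlus ∧ uMinus =ᵐ[volume.restrict (Iio 0)] wMinus ∧ v 0 = α

end MiuraPotential

/-! If `q = u' + u²` with `u ∈ L²`, the form factorizes as `𝔰(φ, y) = ∫ (φ' - u φ)(y' - u y)`. So `e
= exp ∫₀ˣ u` is a positive solution, and for any other `y ∈ Pos(q)` the function `y' - u y` solves
`W' = -u W`, that is `W = c / e`. This is reduction of order: `y = e (1 + c ∫₀ˣ e⁻²)`
(`IsPos.exists_eq`).

If moreover `u ∈ L¹(ℝ⁺)`, then `e` is bounded on `ℝ⁺` and `∫₀^∞ e⁻² = ∞`. Positivity of `y` then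
forces `c ≥ 0`, and extremality of `y` forces `c = 0`. With the mirror image at `-∞`, the functions
`u₊, u₋` in the definition of `classQ` are exactly the extremal representatives. Comparing their
solutions `y₊, y₋` with each other gives `v = u₋ - u₊ = c / (y₊ y₋)`: it is continuous, and `v 0 = c
≥ 0` (`exists_of_miura_eq`).

Uniqueness: `w₋` gives `y₋` on `(-∞, 0]`; then `α` gives `y₊ = y₋ (1 - α ∫₀ˣ y₋⁻²)` and `u₊ = u₋ - α
/ (y₊ y₋)` there. On `ℝ⁺`, `u₊ = w₊`. Thus `u₊`, and with it `q`, is determined.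

Existence: `u₊` and `u₋` have the same Miura transform when `v' = -(u₊ + u₋) v`. With `w` glued from
`w₊` and `w₋`, this is a Bernoulli equation on each half-line, solved by `v = α e⁻² / (1 + α |∫₀ˣ
e⁻²|)` with `e = exp ∫₀ˣ w`. Since `w ∈ L¹`, `e` lies between positive constants, so `v` decays like
`1 / |x|` when `α > 0` and is in `L²` (`exists_riccati_difference`).

The pairing with `q` is a limit over test functions. It is evaluated (`dualPairing_miura`) from the
`H¹`-bound on `u' + u²` and the density of test functions among compactly supported `H¹` functions.
-/

namespace MiuraPotential

/-! ### Calculus of locally absolutely continuous functions -/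

section

/-- `F` is a locally absolutely continuous function with derivative `f`, i.e. `F` is a
primitive of the locally integrable function `f`. -/
def IsPrimitive (F f : ℝ → ℝ) : Prop :=
  LocallyIntegrable f ∧ ∀ x, F x = F 0 + ∫ t in (0 : ℝ)..x, f t

theorem intervalIntegrable_of_locallyIntegrable {f : ℝ → ℝ} (hf : LocallyIntegrable f) (a b : ℝ) :
    IntervalIntegrable f volume a b :=
  intervalIntegrable_iff.mpr <|
    (hf.integrableOn_isCompact isCompact_uIcc).mono_set uIoc_subset_uIcc

theorem isPrimitive_integral {f : ℝ → ℝ} (hf : LocallyIntegrable f) (c : ℝ) :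
    IsPrimitive (fun x => c + ∫ t in (0 : ℝ)..x, f t) f :=
  ⟨hf, fun x => by simp⟩

/-- Postcomposition with a `C¹` function preserves absolute continuity. -/
theorem absolutelyContinuousOnInterval_comp {F h : ℝ → ℝ} {a b : ℝ}
    (hF : AbsolutelyContinuousOnInterval F a b) (hh : ContDiff ℝ 1 h) :
    AbsolutelyContinuousOnInterval (fun x => h (F x)) a b := by
  obtain ⟨C, hC⟩ := hF.exists_bound
  obtain ⟨K, hK⟩ := (hh.contDiffOn (s := Icc (-C) C)).exists_lipschitzOnWith (by decide)
    (convex_Icc _ _) isCompact_Icc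
  rw [absolutelyContinuousOnInterval_iff] at hF ⊢
  intro ε hε
  -- Dividing by `K + 1` rather than `K` covers a vanishing Lipschitz constant.
  obtain ⟨δ, hδ, H⟩ := hF (ε / (K + 1)) (by positivity)
  refine ⟨δ, hδ, fun E hE hEδ => ?_⟩
  have hmem : ∀ x ∈ uIcc a b, F x ∈ Icc (-C) C := fun x hx => by
    have := hC x hx
    rwa [Real.norm_eq_abs, abs_le] at this
  calc
    _ ≤ ∑ i ∈ Finset.range E.1, K * dist (F (E.2 i).1) (F (E.2 i).2) := by
      refine Finset.sum_le_sum fun i hi => ?_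
      exact hK.dist_le_mul _ (hmem _ (hE.left i hi).left) _ (hmem _ (hE.left i hi).right)
    _ = K * ∑ i ∈ Finset.range E.1, dist (F (E.2 i).1) (F (E.2 i).2) := by
      rw [Finset.mul_sum]
    _ ≤ K * (ε / (K + 1)) := by
      gcongr
      exact (H E hE hEδ).le
    _ < (K + 1) * (ε / (K + 1)) := by gcongr; linarith
    _ = ε := by field

namespace IsPrimitive

variable {F G f g : ℝ → ℝ}

theorem sub_eq (hF : IsPrimitive F f) (a b : ℝ) : F b - F a = ∫ t in a..b, f t := by
  rw [hF.2 a, hF.2 b, ← intervalIntegral.integral_add_adjacent_intervals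
    (intervalIntegrable_of_locallyIntegrable hF.1 a 0)
    (intervalIntegrable_of_locallyIntegrable hF.1 0 b), intervalIntegral.integral_symm a 0]
  ring

theorem absolutelyContinuousOnInterval (hF : IsPrimitive F f) (a b : ℝ) :
    AbsolutelyContinuousOnInterval F a b := by
  have h1 := (intervalIntegrable_of_locallyIntegrable hF.1
    a b).absolutelyContinuousOnInterval_intervalIntegral (c := a) left_mem_uIcc
  have h2 : AbsolutelyContinuousOnInterval (fun _ : ℝ => F a) a b :=
    (contDiff_const (n := 1)).contDiffOn.absolutelyContinuousOnInterval
  have h3 : ((fun _ : ℝ => F a) + fun x => ∫ t in a..x, f t) = F := by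
    funext x
    simp only [Pi.add_apply, ← hF.sub_eq]
    ring
  have h := h2.add h1
  rwa [h3] at h

theorem continuous (hF : IsPrimitive F f) : Continuous F := by
  have h := intervalIntegral.continuous_primitive
    (fun a b => intervalIntegrable_of_locallyIntegrable hF.1 a b) 0
  have : F = fun x => F 0 + ∫ t in (0 : ℝ)..x, f t := funext hF.2
  rw [this]
  exact continuous_const.add h

theorem ae_hasDerivAt (hF : IsPrimitive F f) : ∀ᵐ x, HasDerivAt F (f x) x := by
  filter_upwards [LocallyIntegrable.ae_hasDerivAt_integral hF.1] with x hx
  have : F = fun x => F 0 + ∫ t in (0 : ℝ)..x, f t := funext hF.2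
  rw [this]
  exact (hx 0).const_add _

/-- By the fundamental theorem of calculus for absolutely continuous functions. It reduces the
product and chain rules below to pointwise rules almost everywhere. -/
theorem of_absolutelyContinuous (hf : LocallyIntegrable f)
    (hF : ∀ a b, AbsolutelyContinuousOnInterval F a b) (hd : ∀ᵐ x, HasDerivAt F (f x) x) :
    IsPrimitive F f := by
  refine ⟨hf, fun x => ?_⟩
  have h := (hF 0 x).integral_deriv_eq_sub
  have h2 : ∫ t in (0 : ℝ)..x, deriv F t = ∫ t in (0 : ℝ)..x, f t :=
    intervalIntegral.integral_congr_ae (by filter_upwards [hd] with t ht _ using ht.deriv)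
  linarith

theorem congr (hF : IsPrimitive F f) (h : f =ᵐ[volume] g) : IsPrimitive F g :=
  of_absolutelyContinuous (hF.1.congr h) hF.absolutelyContinuousOnInterval (by
    filter_upwards [hF.ae_hasDerivAt, h] with x hx hfg using hfg ▸ hx)

theorem of_contDiff (hF : ContDiff ℝ 1 F) : IsPrimitive F (deriv F) :=
  of_absolutelyContinuous (hF.continuous_deriv le_rfl).locallyIntegrable
    (fun _ _ => hF.contDiffOn.absolutelyContinuousOnInterval)
    (ae_of_all _ fun x => (hF.differentiable one_ne_zero x).hasDerivAt)

theorem sub (hF : IsPrimitive F f) (hG : IsPrimitive G g) :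
    IsPrimitive (fun x => F x - G x) (fun x => f x - g x) :=
  of_absolutelyContinuous (hF.1.sub hG.1)
    (fun a b => (hF.absolutelyContinuousOnInterval a b).sub (hG.absolutelyContinuousOnInterval a b))
    (by filter_upwards [hF.ae_hasDerivAt, hG.ae_hasDerivAt] with x h1 h2 using h1.sub h2)

theorem const_mul (hF : IsPrimitive F f) (c : ℝ) :
    IsPrimitive (fun x => c * F x) (fun x => c * f x) :=
  ⟨hF.1.smul c, fun x => by
    simp only [intervalIntegral.integral_const_mul, hF.2 x]; ring⟩

theorem neg (hF : IsPrimitive F f) : IsPrimitive (fun x => -F x) (fun x => -f x) := by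
  simpa using hF.const_mul (-1)

theorem _root_.MiuraPotential.locallyIntegrable_continuous_mul (hG : Continuous G)
    (hf : LocallyIntegrable f) : LocallyIntegrable fun x => G x * f x := by
  rw [locallyIntegrable_iff] at hf ⊢
  exact fun K hK => (hf K hK).continuousOn_mul hG.continuousOn hK

theorem mul (hF : IsPrimitive F f) (hG : IsPrimitive G g) :
    IsPrimitive (fun x => F x * G x) (fun x => f x * G x + F x * g x) :=
  of_absolutelyContinuous
    ((by simpa only [mul_comm] using locallyIntegrable_continuous_mul hG.continuous hF.1 :
      LocallyIntegrable fun x => f x * G x).add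
      (locallyIntegrable_continuous_mul hF.continuous hG.1))
    (fun a b => (hF.absolutelyContinuousOnInterval a b).fun_mul
      (hG.absolutelyContinuousOnInterval a b))
    (by filter_upwards [hF.ae_hasDerivAt, hG.ae_hasDerivAt] with x h1 h2 using h1.mul h2)

theorem comp {h : ℝ → ℝ} (hF : IsPrimitive F f) (hh : ContDiff ℝ 1 h) :
    IsPrimitive (fun x => h (F x)) (fun x => deriv h (F x) * f x) :=
  of_absolutelyContinuous
    (locallyIntegrable_continuous_mul ((hh.continuous_deriv le_rfl).comp hF.continuous) hF.1)
    (fun a b => absolutelyContinuousOnInterval_comp (hF.absolutelyContinuousOnInterval a b) hh)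
    (by
      filter_upwards [hF.ae_hasDerivAt] with x hx
      exact (hh.differentiable one_ne_zero (F x)).hasDerivAt.comp x hx)

theorem exp (hF : IsPrimitive F f) :
    IsPrimitive (fun x => Real.exp (F x)) (fun x => Real.exp (F x) * f x) := by
  simpa using hF.comp Real.contDiff_exp

theorem eq_zero_ae_of_notMem_tsupport (hF : IsPrimitive F f) :
    ∀ᵐ x, x ∉ tsupport F → f x = 0 := by
  filter_upwards [hF.ae_hasDerivAt] with x hx hxF
  have h0 : F =ᶠ[𝓝 x] fun _ => 0 := by
    rw [notMem_tsupport_iff_eventuallyEq] at hxF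
    exact hxF
  exact hx.unique ((hasDerivAt_const x (0 : ℝ)).congr_of_eventuallyEq h0)

theorem ae_eq_indicator_Icc (hF : IsPrimitive F f) {R : ℝ} (hR : tsupport F ⊆ Icc (-R) R) :
    f =ᵐ[volume] (Icc (-R) R).indicator f := by
  filter_upwards [hF.eq_zero_ae_of_notMem_tsupport] with x hx
  by_cases h : x ∈ Icc (-R) R
  · simp [h]
  · simp [h, hx fun h' => h (hR h')]

theorem _root_.MiuraPotential.exists_tsupport_subset_Icc (hc : HasCompactSupport F) :
    ∃ R, 0 < R ∧ tsupport F ⊆ Icc (-R) R := by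
  obtain ⟨r, hr⟩ := hc.isCompact.isBounded.subset_closedBall 0
  refine ⟨max r 1, by positivity, hr.trans ?_⟩
  rw [Real.closedBall_eq_Icc]
  exact Icc_subset_Icc (by simp) (by simp)

theorem integrable (hF : IsPrimitive F f) (hc : HasCompactSupport F) : Integrable f := by
  obtain ⟨R, -, hR⟩ := exists_tsupport_subset_Icc hc
  exact ((hF.1.integrableOn_isCompact isCompact_Icc).integrable_indicator
    measurableSet_Icc).congr (hF.ae_eq_indicator_Icc hR).symm

theorem integral_eq_zero (hF : IsPrimitive F f) (hc : HasCompactSupport F) : ∫ x, f x = 0 := by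
  obtain ⟨R, hR0, hR⟩ := exists_tsupport_subset_Icc hc
  -- Enlarging the interval puts its endpoints off the support, so the boundary terms vanish.
  have hR' : tsupport F ⊆ Icc (-(R + 1)) (R + 1) :=
    hR.trans (Icc_subset_Icc (by linarith) (by linarith))
  have h0 : ∀ x, x ∉ Icc (-R) R → F x = 0 := fun x hx =>
    image_eq_zero_of_notMem_tsupport fun h => hx (hR h)
  rw [integral_congr_ae (hF.ae_eq_indicator_Icc hR'), integral_indicator measurableSet_Icc,
    integral_Icc_eq_integral_Ioc, ← intervalIntegral.integral_of_le (by linarith), ← hF.sub_eq,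
    h0 _ (by simp), h0 _ (by simp), sub_zero]

theorem memLp_two (hF : IsPrimitive F f) (hc : HasCompactSupport F) (hf : MemL2Loc f) :
    MemLp f 2 volume := by
  obtain ⟨R, -, hR⟩ := exists_tsupport_subset_Icc hc
  exact ((memLp_indicator_iff_restrict measurableSet_Icc).2 (hf _ isCompact_Icc)).ae_eq
    (hF.ae_eq_indicator_Icc hR).symm

end IsPrimitive

end

/-! ### Distributions and weak derivatives -/

section

theorem TestFun.contDiff (φ : TestFun) : ContDiff ℝ (⊤ : ℕ∞) φ := TestFunction.contDiff φ

theorem TestFun.hasCompactSupport (φ : TestFun) : HasCompactSupport φ :=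
  TestFunction.hasCompactSupport φ

theorem TestFun.isPrimitive (φ : TestFun) : IsPrimitive φ (deriv φ) :=
  .of_contDiff (φ.contDiff.of_le (mod_cast le_top))

/-- A smooth compactly supported function as a test function. -/
def TestFun.mk' {g : ℝ → ℝ} (hg : ContDiff ℝ (⊤ : ℕ∞) g) (hc : HasCompactSupport g) : TestFun :=
  ⟨g, hg, hc, by simp⟩

@[simp]
theorem TestFun.coe_mk' {g : ℝ → ℝ} (hg : ContDiff ℝ (⊤ : ℕ∞) g) (hc : HasCompactSupport g) :
    ⇑(TestFun.mk' hg hc) = g := rfl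

theorem TestFun.lineDeriv_apply (φ : TestFun) (x : ℝ) : (∂_{(1 : ℝ)} φ) x = deriv φ x := by
  rw [TestFunction.lineDerivOp_eq_lineDerivCLM ℝ, TestFunction.lineDerivCLM_apply_of_le (by simp)]
  rw [(φ.contDiff.differentiable (by simp) x).lineDeriv_eq_fderiv, fderiv_apply_one_eq_deriv]

variable {f g F G : ℝ → ℝ}

theorem regular_apply (hf : LocallyIntegrable f) (φ : TestFun) :
    regular f φ = ∫ x, φ x * f x := by
  exact TestFunction.integralAgainstBilinCLM_eq_integral
    (B := ContinuousLinearMap.mul ℝ ℝ) (f := φ) (hf.locallyIntegrableOn _)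

theorem lineDeriv_regular_apply (hf : LocallyIntegrable f) (φ : TestFun) :
    (∂_{(1 : ℝ)} (regular f)) φ = -∫ x, deriv φ x * f x := by
  rw [Distribution.lineDerivOp_apply_apply, map_neg, regular_apply hf]
  simp only [TestFun.lineDeriv_apply]

theorem isWeakDeriv_iff (hf : LocallyIntegrable f) (hg : LocallyIntegrable g) :
    IsWeakDeriv f g ↔ ∀ φ : TestFun, ∫ x, deriv φ x * f x = -∫ x, φ x * g x := by
  have : IsWeakDeriv f g ↔ ∂_{(1 : ℝ)} (regular f) = regular g :=
    ⟨fun h => h.2.2, fun h => ⟨hf, hg, h⟩⟩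
  rw [this]
  constructor
  · intro h φ
    have := congrArg (fun T : Distr => T φ) h
    simp only [lineDeriv_regular_apply hf, regular_apply hg] at this
    linarith
  · intro h
    ext φ
    rw [lineDeriv_regular_apply hf, regular_apply hg, h φ, neg_neg]

theorem integrable_continuous_mul (hf : LocallyIntegrable f) (hG : Continuous G)
    (hc : HasCompactSupport G) : Integrable fun x => G x * f x := by
  have := hf.integrable_smul_left_of_hasCompactSupport hG hc
  simpa using this

theorem TestFun.hasCompactSupport_deriv (φ : TestFun) : HasCompactSupport (deriv φ) :=
  φ.hasCompactSupport.deriv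

theorem TestFun.continuous_deriv (φ : TestFun) : Continuous (deriv φ) :=
  φ.contDiff.continuous_deriv (mod_cast le_top)

theorem TestFun.continuous (φ : TestFun) : Continuous φ := φ.contDiff.continuous

theorem IsPrimitive.isWeakDeriv (hF : IsPrimitive F f) : IsWeakDeriv F f := by
  refine (isWeakDeriv_iff hF.continuous.locallyIntegrable hF.1).2 fun φ => ?_
  have h := (φ.isPrimitive.mul hF).integral_eq_zero φ.hasCompactSupport.mul_right
  rw [integral_add (integrable_continuous_mul hF.continuous.locallyIntegrable φ.continuous_deriv
    φ.hasCompactSupport_deriv) (integrable_continuous_mul hF.1 φ.continuous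
    φ.hasCompactSupport)] at h
  linarith

theorem regular_congr (h : f =ᵐ[volume] g) : regular f = regular g := by
  by_cases hf : LocallyIntegrable f
  · ext φ
    rw [regular_apply hf, regular_apply (hf.congr h)]
    exact integral_congr_ae (by filter_upwards [h] with x hx using by rw [hx])
  · have hg : ¬ LocallyIntegrable g := fun hg => hf (hg.congr h.symm)
    exact (TestFunction.integralAgainstBilinCLM_eq_zero (B := ContinuousLinearMap.mul ℝ ℝ)
      (by simpa [locallyIntegrableOn_univ] using hf)).trans
      (TestFunction.integralAgainstBilinCLM_eq_zero (B := ContinuousLinearMap.mul ℝ ℝ)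
      (by simpa [locallyIntegrableOn_univ] using hg)).symm

theorem ae_eq_of_regular_eq (hf : LocallyIntegrable f) (hg : LocallyIntegrable g)
    (h : regular f = regular g) : f =ᵐ[volume] g :=
  ae_eq_of_integral_contDiff_smul_eq hf hg fun χ hχ hc => by
    have := congrArg (fun T : Distr => T (TestFun.mk' hχ hc)) h
    simpa [regular_apply hf, regular_apply hg] using this

theorem IsWeakDeriv.unique {f' : ℝ → ℝ} (hf : IsWeakDeriv F f) (hf' : IsWeakDeriv F f') :
    f =ᵐ[volume] f' :=
  ae_eq_of_regular_eq hf.2.1 hf'.2.1 (hf.2.2.symm.trans hf'.2.2)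

theorem IsWeakDeriv.h1Norm_eq (hf : IsWeakDeriv F f) :
    h1Norm F = eLpNorm F 2 volume + eLpNorm f 2 volume := by
  refine le_antisymm (iInf₂_le f hf) (le_iInf₂ fun g hg => ?_)
  rw [eLpNorm_congr_ae (hf.unique hg)]

/-- A test function with zero mean has a compactly supported primitive. -/
theorem exists_testFun_deriv_eq (hg : ContDiff ℝ (⊤ : ℕ∞) g) {R : ℝ}
    (hs : tsupport g ⊆ Ioo (-R) R) (h0 : ∫ x, g x = 0) :
    ∃ χ : TestFun, deriv χ = g ∧ ∀ x ∉ Icc (-R) R, χ x = 0 := by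
  have hz : ∀ x, x ∉ Ioo (-R) R → g x = 0 := fun x hx =>
    image_eq_zero_of_notMem_tsupport fun h => hx (hs h)
  have hd : ∀ x, HasDerivAt (fun x => ∫ t in (-R)..x, g t) (g x) x := fun x =>
    intervalIntegral.integral_hasDerivAt_right (hg.continuous.intervalIntegrable _ _)
      (hg.continuous.stronglyMeasurableAtFilter _ _) hg.continuous.continuousAt
  have hderiv : deriv (fun x => ∫ t in (-R)..x, g t) = g := funext fun x => (hd x).deriv
  have hout : ∀ x ∉ Icc (-R) R, ∫ t in (-R)..x, g t = 0 := by
    intro x hx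
    rw [mem_Icc, not_and_or, not_le, not_le] at hx
    rcases hx with hx | hx
    · refine intervalIntegral.integral_zero_ae (ae_of_all _ fun t ht => hz t fun h => ?_)
      rw [uIoc_of_ge hx.le] at ht
      exact absurd h.1 (not_lt.2 ht.2)
    · rw [intervalIntegral.integral_eq_integral_of_support_subset, h0]
      intro t ht
      have := hs (subset_tsupport g ht)
      exact ⟨this.1, by linarith [this.2]⟩
  have hc : HasCompactSupport fun x => ∫ t in (-R)..x, g t :=
    HasCompactSupport.intro isCompact_Icc hout
  have hsm : ContDiff ℝ (⊤ : ℕ∞) fun x => ∫ t in (-R)..x, g t := by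
    rw [contDiff_infty_iff_deriv]
    exact ⟨fun x => (hd x).differentiableAt, by rwa [hderiv]⟩
  exact ⟨TestFun.mk' hsm hc, hderiv, hout⟩

/-- There is a nonnegative test function with integral one, supported in `(-1, 1)`. -/
theorem exists_testFun_integral_eq_one :
    ∃ η : TestFun, (∀ x, 0 ≤ η x) ∧ ∫ x, η x = 1 ∧ tsupport η ⊆ Ioo (-1) 1 := by
  let b : ContDiffBump (0 : ℝ) := ⟨1 / 4, 1 / 2, by norm_num, by norm_num⟩
  refine ⟨TestFun.mk' (b.contDiff_normed (μ := volume)) b.hasCompactSupport_normed,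
    fun x => b.nonneg_normed x, b.integral_normed, ?_⟩
  rw [TestFun.coe_mk', b.tsupport_normed_eq, Real.closedBall_eq_Icc]
  exact Icc_subset_Ioo (by norm_num [b]) (by norm_num [b])

/-- The lemma of du Bois-Reymond: a function with vanishing weak derivative is constant. -/
theorem exists_ae_eq_const_of_isWeakDeriv_zero (hf : IsWeakDeriv f fun _ => 0) :
    ∃ c, f =ᵐ[volume] fun _ => c := by
  obtain ⟨η, -, hη1, hηs⟩ := exists_testFun_integral_eq_one
  refine ⟨∫ x, η x * f x, ae_eq_of_integral_contDiff_smul_eq hf.1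
    continuous_const.locallyIntegrable fun φ hφ hc => ?_⟩
  obtain ⟨R, hR0, hR⟩ := exists_tsupport_subset_Icc hc
  have hi : Integrable φ := hφ.continuous.integrable_of_hasCompactSupport hc
  have hηi : Integrable η := η.continuous.integrable_of_hasCompactSupport η.hasCompactSupport
  -- Removing the mean of `φ` by a multiple of `η` leaves the derivative of a test function, which
  -- `f` annihilates.
  have hsupp : tsupport (fun x => φ x - (∫ t, φ t) * η x) ⊆ Ioo (-(R + 1)) (R + 1) := by
    refine (tsupport_sub _ _).trans (union_subset (hR.trans (Icc_subset_Ioo (by linarith)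
      (by linarith))) ((tsupport_mul_subset_right).trans (hηs.trans (Ioo_subset_Ioo (by linarith)
      (by linarith)))))
  obtain ⟨χ, hχ, -⟩ := exists_testFun_deriv_eq (g := fun x => φ x - (∫ t, φ t) * η x)
    (hφ.sub (contDiff_const.mul η.contDiff)) hsupp (by
      rw [integral_sub hi (hηi.const_mul _), integral_const_mul, hη1]; ring)
  have h := (isWeakDeriv_iff hf.1 hf.2.1).1 hf χ
  rw [hχ] at h
  simp only [sub_mul, mul_zero, integral_zero, neg_zero, mul_assoc] at h
  rw [integral_sub (integrable_continuous_mul hf.1 hφ.continuous hc)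
    ((integrable_continuous_mul hf.1 η.continuous η.hasCompactSupport).const_mul _),
    integral_const_mul] at h
  simp only [smul_eq_mul, integral_mul_const]
  linarith

theorem IsWeakDeriv.exists_isPrimitive (hf : IsWeakDeriv F f) :
    ∃ G, IsPrimitive G f ∧ F =ᵐ[volume] G := by
  have h0 := isPrimitive_integral hf.2.1 0
  have hk : IsWeakDeriv (fun x => F x - (0 + ∫ t in (0 : ℝ)..x, f t)) fun _ => 0 := by
    refine (isWeakDeriv_iff (hf.1.sub h0.continuous.locallyIntegrable)
      continuous_const.locallyIntegrable).2 fun φ => ?_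
    simp only [Pi.sub_apply, mul_sub, mul_zero, integral_zero, neg_zero]
    rw [integral_sub (integrable_continuous_mul hf.1 φ.continuous_deriv
      φ.hasCompactSupport_deriv) (integrable_continuous_mul h0.continuous.locallyIntegrable
      φ.continuous_deriv φ.hasCompactSupport_deriv), (isWeakDeriv_iff hf.1 hf.2.1).1 hf,
      (isWeakDeriv_iff h0.continuous.locallyIntegrable hf.2.1).1 h0.isWeakDeriv, sub_self]
  obtain ⟨c, hc⟩ := exists_ae_eq_const_of_isWeakDeriv_zero hk
  refine ⟨_, isPrimitive_integral hf.2.1 c, ?_⟩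
  filter_upwards [hc] with x hx
  linarith

/-- Two continuous functions that agree almost everywhere agree everywhere. -/
theorem IsWeakDeriv.isPrimitive_of_continuous (hf : IsWeakDeriv F f) (hF : Continuous F) :
    IsPrimitive F f := by
  obtain ⟨G, hG, h⟩ := hf.exists_isPrimitive
  rwa [(hF.ae_eq_iff_eq volume hG.continuous).1 h]

theorem MemH1Loc.isPrimitive (h : MemH1Loc F f) : IsPrimitive F f :=
  h.2.1.isPrimitive_of_continuous h.1

end

/-! ### `H¹` estimates and the dual pairing with `u' + u²` -/

section

variable {f g F u : ℝ → ℝ}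

theorem lintegral_enorm_mul_le (hf : AEStronglyMeasurable f) (hg : AEStronglyMeasurable g) :
    ∫⁻ x, ‖f x * g x‖ₑ ≤ eLpNorm f 2 volume * eLpNorm g 2 volume := by
  have := eLpNorm_smul_le_mul_eLpNorm (p := 2) (q := 2) (r := 1) hg hf
  rwa [eLpNorm_one_eq_lintegral_enorm] at this

namespace IsPrimitive

theorem enorm_le_lintegral (hF : IsPrimitive F f) (hc : HasCompactSupport F) (x : ℝ) :
    ‖F x‖ₑ ≤ ∫⁻ t, ‖f t‖ₑ := by
  obtain ⟨R, -, hR⟩ := exists_tsupport_subset_Icc hc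
  have h0 : F (-(R + 1)) = 0 := image_eq_zero_of_notMem_tsupport fun h => by
    have := (hR h).1
    linarith
  have h1 : F x = ∫ t in (-(R + 1))..x, f t := by rw [← hF.sub_eq, h0, sub_zero]
  have h2 : ‖F x‖ₑ = ‖∫ t in uIoc (-(R + 1)) x, f t‖ₑ := by
    rw [h1, ← ofReal_norm, intervalIntegral.norm_integral_eq_norm_integral_uIoc, ofReal_norm]
  rw [h2]
  exact (enorm_integral_le_lintegral_enorm _).trans (setLIntegral_le_lintegral _ _)

/-- The Sobolev embedding `H¹(ℝ) ⊆ L^∞(ℝ)`, for compactly supported functions. -/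
theorem enorm_le (hF : IsPrimitive F f) (hc : HasCompactSupport F) (x : ℝ) :
    ‖F x‖ₑ ≤ eLpNorm F 2 volume + eLpNorm f 2 volume := by
  -- Applied to `F²`: `|F|² ≤ 2 ‖F‖ ‖f‖ ≤ (‖F‖ + ‖f‖)²`.
  have h1 := (hF.mul hF).enorm_le_lintegral hc.mul_right x
  have h2 : ∫⁻ t, ‖f t * F t + F t * f t‖ₑ ≤ 2 * (eLpNorm F 2 volume * eLpNorm f 2 volume) := by
    calc ∫⁻ t, ‖f t * F t + F t * f t‖ₑ = ∫⁻ t, 2 * ‖F t * f t‖ₑ := by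
          congr 1 with t
          rw [show f t * F t + F t * f t = 2 * (F t * f t) by ring, enorm_mul]
          congr 1
          rw [← ofReal_norm]; norm_num
      _ = 2 * ∫⁻ t, ‖F t * f t‖ₑ := lintegral_const_mul' _ _ (by norm_num)
      _ ≤ _ := by
        gcongr
        exact lintegral_enorm_mul_le hF.continuous.aestronglyMeasurable
          hF.1.aestronglyMeasurable
  rw [enorm_mul, ← sq] at h1
  refine (ENNReal.pow_right_strictMono two_ne_zero).le_iff_le.1 (h1.trans (h2.trans ?_))
  rw [add_sq, mul_assoc]
  exact le_add_right le_add_self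

/-- The Poincaré inequality, for functions supported in a fixed bounded interval. -/
theorem exists_eLpNorm_le (R : ℝ) : ∃ C : ℝ≥0∞, C ≠ ∞ ∧ ∀ F f : ℝ → ℝ, IsPrimitive F f →
    tsupport F ⊆ Icc (-R) R → eLpNorm F 2 volume ≤ C * eLpNorm f 2 volume := by
  set A := eLpNorm ((Icc (-R) R).indicator fun _ => (1 : ℝ)) 2 volume with hA
  have hAm : MemLp ((Icc (-R) R).indicator fun _ => (1 : ℝ)) 2 volume :=
    memLp_indicator_const 2 measurableSet_Icc _ (Or.inr measure_Icc_lt_top.ne)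
  have hAtop : A ≠ ∞ := hAm.eLpNorm_ne_top
  refine ⟨A * (volume (Icc (-R) R)) ^ (2 : ℝ≥0∞).toReal⁻¹, ENNReal.mul_ne_top hAtop
    (ENNReal.rpow_ne_top_of_nonneg (by positivity) measure_Icc_lt_top.ne), fun F f hF hs => ?_⟩
  have hc : HasCompactSupport F := isCompact_Icc.of_isClosed_subset (isClosed_tsupport F) hs
  -- Cauchy–Schwarz against the indicator of the interval.
  have h1 : ∫⁻ t, ‖f t‖ₑ ≤ A * eLpNorm f 2 volume := by
    refine le_trans (le_of_eq (lintegral_congr_ae ?_))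
      (lintegral_enorm_mul_le hAm.aestronglyMeasurable hF.1.aestronglyMeasurable)
    filter_upwards [hF.ae_eq_indicator_Icc hs] with x hx
    rw [hx]
    by_cases h : x ∈ Icc (-R) R <;> simp [h]
  rw [← eLpNorm_restrict_eq_of_support_subset ((subset_tsupport F).trans hs)]
  refine (eLpNorm_le_of_ae_enorm_bound (C := A * eLpNorm f 2 volume)
    (ae_of_all _ fun x => (hF.enorm_le_lintegral hc x).trans h1)).trans (le_of_eq ?_)
  rw [smul_eq_mul, Measure.restrict_apply_univ]
  ring

/-- Compactly supported functions in `H¹(ℝ)` are limits of test functions. -/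
theorem exists_testFun_h1Norm_le (hF : IsPrimitive F f) (hc : HasCompactSupport F)
    (hf : MemLp f 2 volume) {ε : ℝ≥0∞} (hε : 0 < ε) :
    ∃ χ : TestFun, h1Norm (fun x => χ x - F x) ≤ ε := by
  obtain ⟨η, -, hη1, hηs⟩ := exists_testFun_integral_eq_one
  obtain ⟨R, hR0, hR⟩ := exists_tsupport_subset_Icc hc
  -- Leaves room for the cutoff `b`, supported in `[-(R + 1), R + 1]`, inside the open interval
  -- `(-S, S)`.
  set S := R + 2 with hS
  obtain ⟨C, hC, hCP⟩ := exists_eLpNorm_le S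
  set A := eLpNorm ((Icc (-S) S).indicator fun _ => (1 : ℝ)) 2 volume with hA
  have hAm : MemLp ((Icc (-S) S).indicator fun _ => (1 : ℝ)) 2 volume :=
    memLp_indicator_const 2 measurableSet_Icc _ (Or.inr measure_Icc_lt_top.ne)
  have hAtop : A ≠ ∞ := hAm.eLpNorm_ne_top
  have hη2 : MemLp η 2 volume := η.continuous.memLp_of_hasCompactSupport η.hasCompactSupport
  have hD : (C + 1) * (1 + A * eLpNorm η 2 volume) ≠ ∞ :=
    ENNReal.mul_ne_top (by simp [hC]) (by simp [ENNReal.mul_ne_top hAtop hη2.eLpNorm_ne_top])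
  obtain ⟨δ, hδ, hδε⟩ := ENNReal.exists_nnreal_pos_mul_lt hD hε.ne'
  obtain ⟨g, hgc, hg, hfg⟩ := hf.exist_eLpNorm_sub_le (by norm_num) (by norm_num) (ε := δ) hδ
  rw [ENNReal.ofReal_coe_nnreal] at hfg
  let b : ContDiffBump (0 : ℝ) := ⟨R, R + 1, hR0, by linarith⟩
  have hb1 : ∀ x ∈ Icc (-R) R, b x = 1 := fun x hx =>
    b.one_of_mem_closedBall (by rwa [Real.closedBall_eq_Icc, zero_sub, zero_add])
  have hbs : tsupport b ⊆ Icc (-(R + 1)) (R + 1) := by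
    rw [b.tsupport_eq, Real.closedBall_eq_Icc, zero_sub, zero_add]
  -- Subtracting `m η` makes `b g` the derivative of a test function. The correction is small: `∫ f
  -- = 0` gives `m = ∫ (b g - f)`.
  set m : ℝ := ∫ x, b x * g x with hm
  have hbg : ContDiff ℝ (⊤ : ℕ∞) fun x => b x * g x := b.contDiff.mul hg
  have hbgi : Integrable fun x => b x * g x :=
    hbg.continuous.integrable_of_hasCompactSupport hgc.mul_left
  have hηi : Integrable η := η.continuous.integrable_of_hasCompactSupport η.hasCompactSupport
  have hsupp : tsupport (fun x => b x * g x - m * η x) ⊆ Ioo (-S) S := by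
    refine (tsupport_sub _ _).trans (union_subset (tsupport_mul_subset_left.trans (hbs.trans
      (Icc_subset_Ioo (by linarith) (by linarith)))) (tsupport_mul_subset_right.trans
      (hηs.trans (Ioo_subset_Ioo (by linarith) (by linarith)))))
  obtain ⟨χ, hχ, hχ0⟩ := exists_testFun_deriv_eq (hbg.sub (contDiff_const.mul η.contDiff))
    hsupp (by
      rw [integral_sub hbgi (hηi.const_mul _), integral_const_mul, hη1]; ring)
  have hfi := hF.integrable hc
  have hf0 := hF.integral_eq_zero hc
  have hbgf : eLpNorm (fun x => b x * g x - f x) 2 volume ≤ δ := by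
    refine le_trans (eLpNorm_mono_enorm_ae ?_) hfg
    filter_upwards [hF.ae_eq_indicator_Icc hR] with x hx
    have hbf : b x * f x = f x := by
      by_cases h : x ∈ Icc (-R) R
      · rw [hb1 x h, one_mul]
      · rw [hx]; simp [h]
    rw [show b x * g x - f x = b x * (g x - f x) by rw [mul_sub, hbf], enorm_mul, Pi.sub_apply,
      ← enorm_neg (f x - g x), neg_sub]
    refine mul_le_of_le_one_left zero_le ?_
    rw [← ofReal_norm, Real.norm_of_nonneg b.nonneg]
    exact ENNReal.ofReal_le_one.2 b.le_one
  have hmA : ‖m‖ₑ ≤ A * δ := by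
    have h1 : m = ∫ x, (b x * g x - f x) := by rw [integral_sub hbgi hfi, hf0, sub_zero]
    rw [h1]
    refine (enorm_integral_le_lintegral_enorm _).trans (le_trans (le_of_eq (lintegral_congr_ae ?_))
      ((lintegral_enorm_mul_le hAm.aestronglyMeasurable
      (hbgi.sub hfi).aestronglyMeasurable).trans (mul_le_mul_right hbgf A)))
    filter_upwards [hF.ae_eq_indicator_Icc hR] with x hx
    by_cases h : x ∈ Icc (-S) S
    · simp [h]
    · have h1 : x ∉ Icc (-R) R := fun h' => h ⟨by linarith [h'.1], by linarith [h'.2]⟩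
      have h2 : b x = 0 := image_eq_zero_of_notMem_tsupport fun h' =>
        h ⟨by linarith [(hbs h').1], by linarith [(hbs h').2]⟩
      simp [h, h2, hx, h1]
  have hK := χ.isPrimitive.sub hF
  rw [hχ] at hK
  have hKs : tsupport (fun x => χ x - F x) ⊆ Icc (-S) S := by
    refine closure_minimal (fun x hx => ?_) isClosed_Icc
    by_contra h
    refine hx ?_
    have h1 : F x = 0 := image_eq_zero_of_notMem_tsupport fun h' =>
      h ⟨by linarith [(hR h').1], by linarith [(hR h').2]⟩
    simp [hχ0 x h, h1]
  have hk : eLpNorm (fun x => b x * g x - m * η x - f x) 2 volume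
      ≤ (1 + A * eLpNorm η 2 volume) * δ := by
    have h1 : (fun x => b x * g x - m * η x - f x)
        = (fun x => b x * g x - f x) - m • (η : ℝ → ℝ) := by
      funext x
      simp only [Pi.sub_apply, Pi.smul_apply, smul_eq_mul]
      ring
    rw [h1]
    refine (eLpNorm_sub_le (hbgi.sub hfi).aestronglyMeasurable
      (hη2.const_smul m).aestronglyMeasurable (by norm_num)).trans ?_
    rw [eLpNorm_const_smul, add_mul, one_mul]
    refine add_le_add hbgf ((mul_le_mul_left hmA _).trans (le_of_eq ?_))
    ring
  refine ⟨χ, ?_⟩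
  -- The Poincaré inequality on `[-S, S]` bounds the `L²` error by that of the derivative.
  rw [hK.isWeakDeriv.h1Norm_eq]
  calc _ ≤ C * ((1 + A * eLpNorm η 2 volume) * δ) + (1 + A * eLpNorm η 2 volume) * δ :=
        add_le_add ((hCP _ _ hK hKs).trans (mul_le_mul_right hk C)) hk
    _ = δ * ((C + 1) * (1 + A * eLpNorm η 2 volume)) := by ring
    _ ≤ ε := hδε.le

end IsPrimitive

/-- The pairing of `u' + u²` with a function `F` with derivative `f`. -/
noncomputable def miuraForm (u F f : ℝ → ℝ) : ℝ :=
  -(∫ x, f x * u x) + ∫ x, F x * u x ^ 2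

theorem miura_apply (hu : MemLp u 2 volume) (φ : TestFun) :
    miura u φ = miuraForm u φ (deriv φ) := by
  have h1 := lineDeriv_regular_apply (hu.locallyIntegrable (by norm_num)) φ
  have h2 := regular_apply hu.integrable_sq.locallyIntegrable φ
  rw [miuraForm, ← h1, ← h2]
  rfl

/-- Cauchy–Schwarz handles `∫ f u`; in `∫ F u²` the factor `F` is bounded by the Sobolev embedding.
-/
theorem enorm_miuraForm_le (hu : MemLp u 2 volume) (hF : IsPrimitive F f)
    (hc : HasCompactSupport F) : ‖miuraForm u F f‖ₑ ≤
      (eLpNorm u 2 volume + eLpNorm u 2 volume * eLpNorm u 2 volume) *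
      (eLpNorm F 2 volume + eLpNorm f 2 volume) := by
  have h1 : ‖∫ x, f x * u x‖ₑ ≤ eLpNorm u 2 volume * eLpNorm f 2 volume :=
    (enorm_integral_le_lintegral_enorm _).trans ((lintegral_enorm_mul_le
      hF.1.aestronglyMeasurable hu.aestronglyMeasurable).trans (le_of_eq (mul_comm _ _)))
  have h2 : ‖∫ x, F x * u x ^ 2‖ₑ ≤ (eLpNorm u 2 volume * eLpNorm u 2 volume) *
      (eLpNorm F 2 volume + eLpNorm f 2 volume) := by
    refine (enorm_integral_le_lintegral_enorm _).trans ?_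
    calc ∫⁻ x, ‖F x * u x ^ 2‖ₑ
        ≤ ∫⁻ x, (eLpNorm F 2 volume + eLpNorm f 2 volume) * ‖u x * u x‖ₑ :=
          lintegral_mono fun x => by
            rw [enorm_mul, sq]
            exact mul_le_mul_left (hF.enorm_le hc x) _
      _ = (eLpNorm F 2 volume + eLpNorm f 2 volume) * ∫⁻ x, ‖u x * u x‖ₑ :=
          lintegral_const_mul'' _ (hu.aestronglyMeasurable.mul hu.aestronglyMeasurable).enorm
      _ ≤ _ := by
          rw [mul_comm]
          exact mul_le_mul_left
            (lintegral_enorm_mul_le hu.aestronglyMeasurable hu.aestronglyMeasurable) _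
  rw [miuraForm]
  refine (enorm_add_le _ _).trans ?_
  rw [enorm_neg, add_mul]
  exact add_le_add (h1.trans (mul_le_mul_right le_add_self _)) h2

theorem memHNegOne_miura (hu : MemLp u 2 volume) : MemHNegOne (miura u) := by
  have hC : eLpNorm u 2 volume + eLpNorm u 2 volume * eLpNorm u 2 volume ≠ ∞ := by
    simp [hu.eLpNorm_ne_top, ENNReal.mul_ne_top]
  refine ⟨(eLpNorm u 2 volume + eLpNorm u 2 volume * eLpNorm u 2 volume).toNNReal, fun φ => ?_⟩
  rw [ENNReal.coe_toNNReal hC, φ.isPrimitive.isWeakDeriv.h1Norm_eq, miura_apply hu]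
  exact enorm_miuraForm_le hu φ.isPrimitive φ.hasCompactSupport

theorem miuraForm_sub {G : ℝ → ℝ} (hu : MemLp u 2 volume) (hF : IsPrimitive F f)
    (hFc : HasCompactSupport F) (hf : MemLp f 2 volume) (hG : IsPrimitive G g)
    (hGc : HasCompactSupport G) (hg : MemLp g 2 volume) :
    miuraForm u (fun x => F x - G x) (fun x => f x - g x) =
      miuraForm u F f - miuraForm u G g := by
  have hsq : LocallyIntegrable fun x => u x ^ 2 := hu.integrable_sq.locallyIntegrable
  simp only [miuraForm, sub_mul]
  have hfu : Integrable fun x => f x * u x := hf.integrable_mul hu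
  have hgu : Integrable fun x => g x * u x := hg.integrable_mul hu
  rw [integral_sub hfu hgu, integral_sub (integrable_continuous_mul hsq hF.continuous hFc)
    (integrable_continuous_mul hsq hG.continuous hGc)]
  ring

/-- The extension of `u' + u²` to compactly supported functions in `H¹(ℝ)`. -/
theorem dualPairing_miura (hu : MemLp u 2 volume) (hF : IsPrimitive F f)
    (hc : HasCompactSupport F) (hf : MemLp f 2 volume) :
    dualPairing (miura u) F = miuraForm u F f := by
  -- Density of test functions makes the filter nontrivial, so that `limUnder` is a genuine limit.
  have hne : (comap (fun χ : TestFun => h1Norm (fun x => χ x - F x)) (𝓝 0)).NeBot := by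
    refine comap_neBot_iff.2 fun t ht => ?_
    obtain ⟨ε, hε, hεt⟩ := ENNReal.nhds_zero_basis_Iic.mem_iff.1 ht
    obtain ⟨χ, hχ⟩ := hF.exists_testFun_h1Norm_le hc hf hε
    exact ⟨χ, hεt hχ⟩
  refine Tendsto.limUnder_eq (tendsto_iff_edist_tendsto_0.2 ?_)
  have hC : eLpNorm u 2 volume + eLpNorm u 2 volume * eLpNorm u 2 volume ≠ ∞ := by
    simp [hu.eLpNorm_ne_top, ENNReal.mul_ne_top]
  have h0 := ENNReal.Tendsto.const_mul
    (tendsto_comap (f := fun χ : TestFun => h1Norm (fun x => χ x - F x)) (x := 𝓝 0))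
    (Or.inr hC)
  rw [mul_zero] at h0
  refine tendsto_of_tendsto_of_tendsto_of_le_of_le tendsto_const_nhds h0 (fun _ => zero_le)
    fun χ => ?_
  have hχ2 : MemLp (deriv χ) 2 volume :=
    χ.continuous_deriv.memLp_of_hasCompactSupport χ.hasCompactSupport_deriv
  have hsub := χ.isPrimitive.sub hF
  simp only [edist_eq_enorm_sub]
  rw [miura_apply hu, ← miuraForm_sub hu χ.isPrimitive χ.hasCompactSupport hχ2 hF hc hf,
    hsub.isWeakDeriv.h1Norm_eq]
  exact enorm_miuraForm_le hu hsub (χ.hasCompactSupport.sub hc)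

end

/-! ### Positive solutions, reduction of order and extremality -/

section

variable {f g F G u y y' : ℝ → ℝ}

theorem memL2Loc_of_memLp (hu : MemLp u 2 volume) : MemL2Loc u := fun K _ => hu.restrict K

theorem MemL2Loc.continuous_mul (hf : MemL2Loc f) (hG : Continuous G) :
    MemL2Loc fun x => G x * f x := by
  intro K hK
  obtain ⟨C, hC⟩ := hK.exists_bound_of_continuousOn hG.continuousOn
  refine (hf K hK).of_le_mul (c := C)
    (hG.aestronglyMeasurable.mul (hf K hK).aestronglyMeasurable) ?_
  filter_upwards [ae_restrict_mem hK.measurableSet] with x hx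
  rw [norm_mul]
  exact mul_le_mul_of_nonneg_right (hC x hx) (norm_nonneg _)

theorem MemL2Loc.sub (hf : MemL2Loc f) (hg : MemL2Loc g) : MemL2Loc fun x => f x - g x :=
  fun K hK => (hf K hK).sub (hg K hK)

theorem MemL2Loc.add (hf : MemL2Loc f) (hg : MemL2Loc g) : MemL2Loc fun x => f x + g x :=
  fun K hK => (hf K hK).add (hg K hK)

theorem MemL2Loc.locallyIntegrable_mul (hf : MemL2Loc f) (hg : MemL2Loc g) :
    LocallyIntegrable fun x => f x * g x :=
  locallyIntegrable_iff.2 fun K hK => (hf K hK).integrable_mul (hg K hK)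

theorem MemH1Loc.memLp_testFun_mul (hy : MemH1Loc y y') (φ : TestFun) :
    MemLp (fun x => deriv φ x * y x + φ x * y' x) 2 volume := by
  refine (φ.isPrimitive.mul hy.isPrimitive).memLp_two φ.hasCompactSupport.mul_right
    (MemL2Loc.add ?_ (hy.2.2.continuous_mul φ.continuous))
  exact memL2Loc_of_memLp ((φ.continuous_deriv.mul hy.1).memLp_of_hasCompactSupport
    φ.hasCompactSupport_deriv.mul_right)

/-- Weak form of the factorization `-∂² + u' + u² = -(∂ + u)(∂ - u)`. -/
theorem form_miura (hu : MemLp u 2 volume) (hy : MemH1Loc y y') (φ : TestFun) :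
    form (miura u) φ y y' =
      (∫ x, deriv φ x * (y' x - u x * y x)) - ∫ x, φ x * (u x * (y' x - u x * y x)) := by
  have hP := φ.isPrimitive.mul hy.isPrimitive
  have h2 := hy.memLp_testFun_mul φ
  have hul := hu.locallyIntegrable (by norm_num)
  have hsq : LocallyIntegrable fun x => u x ^ 2 := hu.integrable_sq.locallyIntegrable
  have huy : MemL2Loc fun x => u x * y x := by
    simpa only [mul_comm] using (memL2Loc_of_memLp hu).continuous_mul hy.1
  have hw : MemL2Loc fun x => y' x - u x * y x := hy.2.2.sub huy
  have hwl : LocallyIntegrable fun x => y' x - u x * y x :=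
    hy.2.1.2.1.sub (by simpa only [mul_comm] using locallyIntegrable_continuous_mul hy.1 hul)
  have i1 : Integrable fun x => deriv φ x * (y' x - u x * y x) :=
    integrable_continuous_mul hwl φ.continuous_deriv φ.hasCompactSupport_deriv
  have i2 : Integrable fun x => φ x * (u x * (y' x - u x * y x)) :=
    integrable_continuous_mul ((memL2Loc_of_memLp hu).locallyIntegrable_mul hw) φ.continuous
      φ.hasCompactSupport
  have i3 : Integrable fun x => (deriv φ x * y x + φ x * y' x) * u x := h2.integrable_mul hu
  have i4 : Integrable fun x => φ x * y x * u x ^ 2 :=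
    integrable_continuous_mul hsq (φ.continuous.mul hy.1) φ.hasCompactSupport.mul_right
  have i5 : Integrable fun x => deriv φ x * y' x :=
    integrable_continuous_mul hy.2.1.2.1 φ.continuous_deriv φ.hasCompactSupport_deriv
  have i6 : Integrable fun x =>
      φ x * y x * u x ^ 2 - (deriv φ x * y x + φ x * y' x) * u x := i4.sub i3
  rw [form, dualPairing_miura hu hP φ.hasCompactSupport.mul_right h2, miuraForm,
    neg_add_eq_sub, ← integral_sub i1 i2, ← integral_sub i4 i3, ← integral_add i5 i6]
  congr 1 with x
  ring

/-- The solution `y = exp (∫₀ˣ u)` of `y' = u y` with `y 0 = 1`. -/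
noncomputable def expInt (u : ℝ → ℝ) (x : ℝ) : ℝ := Real.exp (∫ t in (0 : ℝ)..x, u t)

/-- The primitive `∫₀ˣ y⁻²`. -/
noncomputable def invSqInt (y : ℝ → ℝ) (x : ℝ) : ℝ := ∫ t in (0 : ℝ)..x, 1 / y t ^ 2

theorem expInt_pos (u : ℝ → ℝ) (x : ℝ) : 0 < expInt u x := Real.exp_pos _

@[simp]
theorem expInt_zero (u : ℝ → ℝ) : expInt u 0 = 1 := by simp [expInt]

theorem isPrimitive_expInt (hu : LocallyIntegrable u) :
    IsPrimitive (expInt u) fun x => expInt u x * u x := by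
  have h := (isPrimitive_integral hu 0).exp
  simp only [zero_add] at h
  exact h

theorem isPrimitive_inv_expInt (hu : LocallyIntegrable u) :
    IsPrimitive (fun x => (expInt u x)⁻¹) fun x => -((expInt u x)⁻¹ * u x) := by
  have h := (isPrimitive_integral hu 0).neg.exp
  simp only [zero_add, Real.exp_neg, mul_neg] at h
  exact h

theorem isPos_expInt (hu : MemLp u 2 volume) :
    IsPos (miura u) (expInt u) fun x => expInt u x * u x := by
  have hP := isPrimitive_expInt (hu.locallyIntegrable (by norm_num))
  have hm : MemH1Loc (expInt u) fun x => expInt u x * u x :=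
    ⟨hP.continuous, hP.isWeakDeriv, (memL2Loc_of_memLp hu).continuous_mul hP.continuous⟩
  refine ⟨hm, expInt_zero u, expInt_pos u, fun φ => ?_⟩
  rw [form_miura hu hm]
  simp [mul_comm]

theorem IsPrimitive.eq_of_ae_eq_zero (hF : IsPrimitive F f) (h : f =ᵐ[volume] 0) (x : ℝ) :
    F x = F 0 := by
  rw [(hF.congr h).2 x]
  simp

/-- All elements of `Pos (u' + u²)` are obtained from `exp (∫₀ˣ u)` by reduction of order. -/
theorem IsPos.exists_eq (hu : MemLp u 2 volume) (hy : IsPos (miura u) y y') :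
    ∃ c : ℝ, (∀ x, y x = expInt u x * (1 + c * invSqInt (expInt u) x)) ∧
      ∀ᵐ x, y' x = u x * y x + c / expInt u x := by
  have hul := hu.locallyIntegrable (by norm_num)
  have hm := hy.memH1Loc
  have huy : MemL2Loc fun x => u x * y x := by
    simpa only [mul_comm] using (memL2Loc_of_memLp hu).continuous_mul hm.1
  have hw : MemL2Loc fun x => y' x - u x * y x := hm.2.2.sub huy
  have hwl : LocallyIntegrable fun x => y' x - u x * y x :=
    hm.2.1.2.1.sub (by simpa only [mul_comm] using locallyIntegrable_continuous_mul hm.1 hul)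
  have huw : LocallyIntegrable fun x => -(u x * (y' x - u x * y x)) :=
    ((memL2Loc_of_memLp hu).locallyIntegrable_mul hw).neg
  have hweak : IsWeakDeriv (fun x => y' x - u x * y x)
      fun x => -(u x * (y' x - u x * y x)) := by
    refine (isWeakDeriv_iff hwl huw).2 fun φ => ?_
    have h := hy.solution φ
    rw [form_miura hu hm] at h
    simp only [mul_neg, integral_neg, neg_neg]
    linarith
  obtain ⟨W, hW, hwW⟩ := hweak.exists_isPrimitive
  -- `W' = -u W` and `(expInt u)' = u · expInt u`, so the product is constant.
  have hc := fun x => (hW.mul (isPrimitive_expInt hul)).eq_of_ae_eq_zero (by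
    filter_upwards [hwW] with x hx
    rw [hx, Pi.zero_apply]
    ring) x
  have hWc : ∀ x, W x = W 0 / expInt u x := fun x => by
    rw [eq_div_iff (expInt_pos u x).ne', hc x, expInt_zero, mul_one]
  refine ⟨W 0, fun x => ?_, ?_⟩
  -- The quotient `y / expInt u` has derivative `W 0 / (expInt u)²`.
  · have hZ := (hm.isPrimitive.mul (isPrimitive_inv_expInt hul)).congr
      (g := fun x => W 0 * (1 / expInt u x ^ 2)) (by
        filter_upwards [hwW] with x hx
        have : y' x = u x * y x + W 0 / expInt u x := by rw [← hWc]; linarith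
        rw [this]
        have := (expInt_pos u x).ne'
        field_simp
        ring)
    have h := hZ.2 x
    simp only [hy.normalized, expInt_zero, intervalIntegral.integral_const_mul, inv_one,
      mul_one] at h
    rw [invSqInt, ← h]
    have := (expInt_pos u x).ne'
    field_simp
  · filter_upwards [hwW] with x hx
    rw [← hWc]
    linarith

/-- For `u ∈ L¹(s)`, the function `exp (∫₀ˣ u)` is bounded on `s`, if `s` is a half-line with
vertex `0`. -/
theorem expInt_le {s : Set ℝ} (hus : IntegrableOn u s) {x : ℝ} (hx : uIoc 0 x ⊆ s) :
    expInt u x ≤ Real.exp (∫ t in s, ‖u t‖) := by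
  refine Real.exp_le_exp.2 ((le_abs_self _).trans ?_)
  rw [← Real.norm_eq_abs, intervalIntegral.norm_integral_eq_norm_integral_uIoc]
  exact (norm_integral_le_integral_norm _).trans
    (setIntegral_mono_set hus.norm (ae_of_all _ fun t => norm_nonneg _) hx.eventuallyLE)

theorem lintegral_inv_sq_eq_top {s : Set ℝ} (hs : MeasurableSet s) (hsv : volume s = ∞) {M : ℝ}
    (hy : ∀ x ∈ s, 0 < y x) (hM : ∀ x ∈ s, y x ≤ M) :
    ∫⁻ x in s, ENNReal.ofReal (1 / y x ^ 2) = ∞ := by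
  obtain ⟨x₀, hx₀⟩ : s.Nonempty := nonempty_of_measure_ne_zero (μ := volume) (by simp [hsv])
  have hM0 : 0 < M := (hy x₀ hx₀).trans_le (hM x₀ hx₀)
  refine top_le_iff.1 ?_
  calc ∞ = ∫⁻ _ in s, ENNReal.ofReal (1 / M ^ 2) := by
        rw [setLIntegral_const, hsv, ENNReal.mul_top]
        simp only [ne_eq, ENNReal.ofReal_eq_zero, not_le]
        positivity
    _ ≤ _ := setLIntegral_mono' hs fun x hx => by
        have := hy x hx
        have := hM x hx
        gcongr

theorem lintegral_expInt_Ioi (hu : IntegrableOn u (Ioi 0)) :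
    ∫⁻ s in Ioi 0, ENNReal.ofReal (1 / expInt u s ^ 2) = ∞ :=
  lintegral_inv_sq_eq_top measurableSet_Ioi (by simp) (fun x _ => expInt_pos u x)
    fun x hx => expInt_le hu (by
      rw [uIoc_of_le (le_of_lt hx)]
      exact Ioc_subset_Ioi_self)

theorem lintegral_expInt_Iio (hu : IntegrableOn u (Iio 0)) :
    ∫⁻ s in Iio 0, ENNReal.ofReal (1 / expInt u s ^ 2) = ∞ :=
  lintegral_inv_sq_eq_top measurableSet_Iio (by simp) (fun x _ => expInt_pos u x)
    -- For `x < 0`, `uIoc 0 x` is `Ioc x 0`, which contains `0`; hence the closed half-line.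
    fun x hx => expInt_le ((integrableOn_Iic_iff_integrableOn_Iio).2 hu) (by
      rw [uIoc_of_ge (le_of_lt hx)]
      exact Ioc_subset_Iic_self)

theorem isRightExtremalRep_miura (hu : MemLp u 2 volume) (hu1 : IntegrableOn u (Ioi 0)) :
    IsRightExtremalRep (miura u) u :=
  ⟨_, _, isPos_expInt hu, lintegral_expInt_Ioi hu1, ae_of_all _ fun x => by
    simp [(expInt_pos u x).ne']⟩

theorem isLeftExtremalRep_miura (hu : MemLp u 2 volume) (hu1 : IntegrableOn u (Iio 0)) :
    IsLeftExtremalRep (miura u) u :=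
  ⟨_, _, isPos_expInt hu, lintegral_expInt_Iio hu1, ae_of_all _ fun x => by
    simp [(expInt_pos u x).ne']⟩

theorem hasDerivAt_invSqInt (hy : Continuous y) (h0 : ∀ x, 0 < y x) (x : ℝ) :
    HasDerivAt (invSqInt y) (1 / y x ^ 2) x := by
  have hc : Continuous fun t => 1 / y t ^ 2 :=
    continuous_const.div (hy.pow 2) fun t => (pow_pos (h0 t) 2).ne'
  exact intervalIntegral.integral_hasDerivAt_right (hc.intervalIntegrable _ _)
    (hc.stronglyMeasurableAtFilter _ _) hc.continuousAt

theorem exists_lt_invSqInt (hy : Continuous y) (h0 : ∀ x, 0 < y x)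
    (h : ∫⁻ s in Ioi 0, ENNReal.ofReal (1 / y s ^ 2) = ∞) (B : ℝ) :
    ∃ x, 0 < x ∧ B < invSqInt y x := by
  by_contra! hB
  have hc : Continuous fun t => 1 / y t ^ 2 :=
    continuous_const.div (hy.pow 2) fun t => (pow_pos (h0 t) 2).ne'
  have hnn : ∀ t, 0 ≤ 1 / y t ^ 2 := fun t => by positivity
  have hi : IntegrableOn (fun t => 1 / y t ^ 2) (Ioi 0) := by
    refine integrableOn_Ioi_of_intervalIntegral_norm_bounded B 0 (b := fun x : ℝ => x)
      (l := atTop) (fun i => hc.integrableOn_Ioc) tendsto_id ?_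
    filter_upwards [eventually_gt_atTop 0] with x hx
    refine le_trans (le_of_eq ?_) (hB x hx)
    exact intervalIntegral.integral_congr fun t _ => by
      simp only [Real.norm_of_nonneg (hnn t)]
  have := hi.lintegral_lt_top
  rw [h] at this
  exact lt_irrefl _ this

/-- If `c < 0`, then `1 + c ∫₀ˣ y⁻²` is negative once the divergent integral exceeds `-1 / c`. -/
theorem nonneg_of_lintegral_inv_sq_eq_top {z : ℝ → ℝ} {c : ℝ} (hy : Continuous y)
    (h0 : ∀ x, 0 < y x) (hz : ∀ x, z x = y x * (1 + c * invSqInt y x)) (hz0 : ∀ x, 0 < z x)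
    (h : ∫⁻ s in Ioi 0, ENNReal.ofReal (1 / y s ^ 2) = ∞) : 0 ≤ c := by
  by_contra! hc
  obtain ⟨x, -, hx⟩ := exists_lt_invSqInt hy h0 h (-1 / c)
  have h1 := hz x ▸ hz0 x
  have h2 := pos_of_mul_pos_right h1 (h0 x).le
  rw [div_lt_iff_of_neg hc] at hx
  linarith

/-- For `c > 0`, `z⁻²` has the primitive `-(1 / c) (1 + c ∫₀ˣ y⁻²)⁻¹`, so `∫₀ˣ z⁻² < 1 / c`,
contradicting divergence. -/
theorem eq_zero_of_lintegral_inv_sq_eq_top {z : ℝ → ℝ} {c : ℝ} (hy : Continuous y)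
    (h0 : ∀ x, 0 < y x) (hz : ∀ x, z x = y x * (1 + c * invSqInt y x)) (hz0 : ∀ x, 0 < z x)
    (h : ∫⁻ s in Ioi 0, ENNReal.ofReal (1 / y s ^ 2) = ∞)
    (hz' : ∫⁻ s in Ioi 0, ENNReal.ofReal (1 / z s ^ 2) = ∞) : c = 0 := by
  have hc := nonneg_of_lintegral_inv_sq_eq_top hy h0 hz hz0 h
  by_contra hne
  have hc0 : 0 < c := lt_of_le_of_ne hc (Ne.symm hne)
  have hT : ∀ x, 0 < 1 + c * invSqInt y x := fun x =>
    pos_of_mul_pos_right (hz x ▸ hz0 x) (h0 x).le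
  have hI : Continuous (invSqInt y) :=
    continuous_iff_continuousAt.2 fun x => (hasDerivAt_invSqInt hy h0 x).continuousAt
  have hzc : Continuous z := by
    rw [funext hz]
    fun_prop
  obtain ⟨x, -, hx⟩ := exists_lt_invSqInt hzc hz0 hz' (1 / c)
  have hd : ∀ t, HasDerivAt (fun t => -(1 / c) * (1 + c * invSqInt y t)⁻¹) (1 / z t ^ 2) t := by
    intro t
    have := ((((hasDerivAt_invSqInt hy h0 t).const_mul c).const_add 1).inv
      (hT t).ne').const_mul (-(1 / c))
    refine this.congr_deriv ?_
    rw [hz t]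
    have := h0 t
    have := hT t
    field_simp
  have hcz : Continuous fun t => 1 / z t ^ 2 :=
    continuous_const.div (hzc.pow 2) fun t => (pow_pos (hz0 t) 2).ne'
  have hJ : invSqInt z x = -(1 / c) * (1 + c * invSqInt y x)⁻¹ -
      -(1 / c) * (1 + c * invSqInt y 0)⁻¹ :=
    intervalIntegral.integral_eq_sub_of_hasDerivAt (fun t _ => hd t)
      (hcz.intervalIntegrable _ _)
  have h00 : invSqInt y 0 = 0 := by simp [invSqInt]
  rw [h00, mul_zero, add_zero, inv_one, mul_one, sub_neg_eq_add] at hJ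
  have : 0 < 1 / c * (1 + c * invSqInt y x)⁻¹ := mul_pos (by positivity) (inv_pos.2 (hT x))
  linarith

theorem invSqInt_comp_neg (y : ℝ → ℝ) (x : ℝ) :
    invSqInt (fun t => y (-t)) x = -invSqInt y (-x) := by
  rw [invSqInt, invSqInt, intervalIntegral.integral_comp_neg (fun t => 1 / y t ^ 2), neg_zero,
    intervalIntegral.integral_symm]

theorem lintegral_Ioi_comp_neg (k : ℝ → ℝ≥0∞) :
    ∫⁻ s in Ioi 0, k (-s) = ∫⁻ s in Iio 0, k s := by
  have h := (Measure.measurePreserving_neg (volume : Measure ℝ)).setLIntegral_comp_preimage_emb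
    (Homeomorph.neg ℝ).measurableEmbedding k (Iio 0)
  simpa using h

/-- The reflection `x ↦ -x` reduces this to the case of `+∞`, with `c` replaced by `-c`. -/
theorem eq_zero_of_lintegral_Iio_inv_sq_eq_top {z : ℝ → ℝ} {c : ℝ} (hy : Continuous y)
    (h0 : ∀ x, 0 < y x) (hz : ∀ x, z x = y x * (1 + c * invSqInt y x)) (hz0 : ∀ x, 0 < z x)
    (h : ∫⁻ s in Iio 0, ENNReal.ofReal (1 / y s ^ 2) = ∞)
    (hz' : ∫⁻ s in Iio 0, ENNReal.ofReal (1 / z s ^ 2) = ∞) : c = 0 := by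
  have := eq_zero_of_lintegral_inv_sq_eq_top (y := fun t => y (-t)) (z := fun t => z (-t))
    (c := -c) (hy.comp continuous_neg) (fun x => h0 _)
    (fun x => by rw [invSqInt_comp_neg, hz]; ring) (fun x => hz0 _)
    (by rw [← h]; exact lintegral_Ioi_comp_neg fun s => ENNReal.ofReal (1 / y s ^ 2))
    (by rw [← hz']; exact lintegral_Ioi_comp_neg fun s => ENNReal.ofReal (1 / z s ^ 2))
  linarith

end

/-! ### Extremal representatives: uniqueness and comparison -/

section

variable {u uP uM : ℝ → ℝ}

theorem miura_congr {v : ℝ → ℝ} (h : u =ᵐ[volume] v) : miura u = miura v := by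
  have h2 : (fun x => u x ^ 2) =ᵐ[volume] fun x => v x ^ 2 := by
    filter_upwards [h] with x hx using by rw [hx]
  rw [miura, miura, regular_congr h, regular_congr h2]

theorem continuous_expInt (hu : MemLp u 2 volume) : Continuous (expInt u) :=
  (isPrimitive_expInt (hu.locallyIntegrable (by norm_num))).continuous

theorem IsRightExtremalRep.ae_eq (hu : MemLp uP 2 volume) (hu1 : IntegrableOn uP (Ioi 0))
    (h : IsRightExtremalRep (miura uP) u) : u =ᵐ[volume] uP := by
  obtain ⟨y, y', hy, hy2, huy⟩ := h
  obtain ⟨c, hyc, hyc'⟩ := hy.exists_eq hu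
  have hc := eq_zero_of_lintegral_inv_sq_eq_top (continuous_expInt hu) (expInt_pos uP) hyc hy.pos
    (lintegral_expInt_Ioi hu1) hy2
  filter_upwards [huy, hyc'] with x h1 h2
  rw [h1, h2, hc, zero_div, add_zero, mul_div_cancel_right₀ _ (hy.pos x).ne']

theorem IsLeftExtremalRep.ae_eq (hu : MemLp uM 2 volume) (hu1 : IntegrableOn uM (Iio 0))
    (h : IsLeftExtremalRep (miura uM) u) : u =ᵐ[volume] uM := by
  obtain ⟨y, y', hy, hy2, huy⟩ := h
  obtain ⟨c, hyc, hyc'⟩ := hy.exists_eq hu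
  have hc := eq_zero_of_lintegral_Iio_inv_sq_eq_top (continuous_expInt hu) (expInt_pos uM) hyc
    hy.pos (lintegral_expInt_Iio hu1) hy2
  filter_upwards [huy, hyc'] with x h1 h2
  rw [h1, h2, hc, zero_div, add_zero, mul_div_cancel_right₀ _ (hy.pos x).ne']

/-- Two Riccati representatives of the same distribution, extremal at `+∞` and at `-∞`
respectively, determine each other through their difference at `0`. -/
theorem exists_of_miura_eq (hP : MemLp uP 2 volume) (hP1 : IntegrableOn uP (Ioi 0))
    (hM : MemLp uM 2 volume) (h : miura uP = miura uM) :
    ∃ c : ℝ, 0 ≤ c ∧ (∀ x, expInt uP x = expInt uM x * (1 - c * invSqInt (expInt uM) x)) ∧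
      ∀ᵐ x, uM x - uP x = c / (expInt uP x * expInt uM x) := by
  obtain ⟨c, hc, hc'⟩ := (h ▸ isPos_expInt hM).exists_eq hP
  obtain ⟨d, hd, hd'⟩ := (h ▸ isPos_expInt hP).exists_eq hM
  have h1 : ∀ᵐ x, uM x - uP x = c / (expInt uP x * expInt uM x) := by
    filter_upwards [hc'] with x hx
    have := (expInt_pos uP x).ne'
    have := (expInt_pos uM x).ne'
    field_simp at hx ⊢
    linarith
  have h2 : ∀ᵐ x, uP x - uM x = d / (expInt uP x * expInt uM x) := by
    filter_upwards [hd'] with x hx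
    have := (expInt_pos uP x).ne'
    have := (expInt_pos uM x).ne'
    field_simp at hx ⊢
    linarith
  -- The two formulas for the difference need only be compared at one point where both hold.
  have hdc : d = -c := by
    obtain ⟨x, hx1, hx2⟩ := (h1.and h2).exists
    have h3 : d / (expInt uP x * expInt uM x) = -c / (expInt uP x * expInt uM x) := by
      rw [neg_div]
      linarith
    exact (div_left_inj' (mul_pos (expInt_pos uP x) (expInt_pos uM x)).ne').1 h3
  refine ⟨c, ?_, fun x => ?_, h1⟩
  · exact nonneg_of_lintegral_inv_sq_eq_top (continuous_expInt hP) (expInt_pos uP) hc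
      (expInt_pos uM) (lintegral_expInt_Ioi hP1)
  · rw [hd x, hdc]
    ring

theorem continuous_div_expInt (hP : MemLp uP 2 volume) (hM : MemLp uM 2 volume) (c : ℝ) :
    Continuous fun x => c / (expInt uP x * expInt uM x) :=
  continuous_const.div ((continuous_expInt hP).mul (continuous_expInt hM))
    fun x => (mul_pos (expInt_pos uP x) (expInt_pos uM x)).ne'

/-- Every `q ∈ 𝒬` with extremal data `(w₊, w₋, α)` is `u' + u²` for a function `u` that is
explicitly determined by the data. -/
theorem HasExtremalData.exists_eq {q : Distr} {wPlus wMinus : ℝ → ℝ} {α : ℝ}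
    (hq : q ∈ classQ) (h : HasExtremalData q wPlus wMinus α) :
    ∃ uP uM : ℝ → ℝ, q = miura uP ∧ uP =ᵐ[volume.restrict (Ioi 0)] wPlus ∧
      uM =ᵐ[volume.restrict (Iio 0)] wMinus ∧
      (∀ x, expInt uP x = expInt uM x * (1 - α * invSqInt (expInt uM) x)) ∧
      ∀ᵐ x, uM x - uP x = α / (expInt uP x * expInt uM x) := by
  obtain ⟨-, uP, uM, ⟨hP, hP1⟩, ⟨hM, hM1⟩, hqP, hqM⟩ := hq
  obtain ⟨u₁, u₂, v, h1, h2, hv, hvu, hu1, hu2, hv0⟩ := h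
  have e1 : u₁ =ᵐ[volume] uP := (hqP ▸ h1).ae_eq hP hP1
  have e2 : u₂ =ᵐ[volume] uM := (hqM ▸ h2).ae_eq hM hM1
  obtain ⟨c, -, hc, hc'⟩ := exists_of_miura_eq hP hP1 hM (hqP.symm.trans hqM)
  have hvc : v = fun x => c / (expInt uP x * expInt uM x) := by
    refine (hv.ae_eq_iff_eq volume (continuous_div_expInt hP hM c)).1 ?_
    filter_upwards [hvu, e1, e2, hc'] with x hx h3 h4 h5
    rw [hx, h3, h4, h5]
  have hcα : c = α := by
    rw [← hv0, hvc]
    simp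
  subst hcα
  exact ⟨uP, uM, hqP, e1.symm.restrict.trans hu1, e2.symm.restrict.trans hu2, hc, hc'⟩

theorem expInt_congr_of_nonpos {u v : ℝ → ℝ} (h : u =ᵐ[volume.restrict (Iio 0)] v) {x : ℝ}
    (hx : x ≤ 0) : expInt u x = expInt v x := by
  rw [expInt, expInt]
  congr 1
  refine intervalIntegral.integral_congr_ae ?_
  rw [Filter.EventuallyEq, ae_restrict_congr_set Iio_ae_eq_Iic,
    ae_restrict_iff' measurableSet_Iic] at h
  filter_upwards [h] with t ht hxt
  rw [uIoc_of_ge hx] at hxt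
  exact ht hxt.2

/-- It suffices to recover `u₊` almost everywhere. On `(0, ∞)` it is prescribed; on `(-∞, 0)` the
explicit formulas express it through `w₋` and `α`. -/
theorem HasExtremalData.unique {q r : Distr} {wPlus wMinus : ℝ → ℝ} {α : ℝ}
    (hq : q ∈ classQ) (hqd : HasExtremalData q wPlus wMinus α)
    (hr : r ∈ classQ) (hrd : HasExtremalData r wPlus wMinus α) : q = r := by
  obtain ⟨uP, uM, rfl, h1, h2, h3, h4⟩ := hqd.exists_eq hq
  obtain ⟨zP, zM, rfl, k1, k2, k3, k4⟩ := hrd.exists_eq hr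
  refine miura_congr ?_
  have hM : uM =ᵐ[volume.restrict (Iio 0)] zM := h2.trans k2.symm
  have hP : uP =ᵐ[volume.restrict (Ioi 0)] zP := h1.trans k1.symm
  have eM : ∀ x ≤ 0, expInt uM x = expInt zM x := fun x hx => expInt_congr_of_nonpos hM hx
  have eP : ∀ x ≤ 0, expInt uP x = expInt zP x := fun x hx => by
    rw [h3, k3, eM x hx]
    congr 3
    refine intervalIntegral.integral_congr fun t ht => ?_
    rw [uIcc_of_ge hx] at ht
    simp only [eM t ht.2]
  rw [Filter.EventuallyEq, ae_restrict_iff' measurableSet_Iio] at hM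
  rw [Filter.EventuallyEq, ae_restrict_iff' measurableSet_Ioi] at hP
  filter_upwards [hM, hP, h4, k4, Measure.ae_ne volume 0] with x a1 a2 a3 a4 a5
  rcases lt_or_gt_of_ne a5 with hx | hx
  · have := a1 hx
    rw [eM x hx.le, eP x hx.le] at a3
    linarith
  · exact a2 hx

theorem memX0Plus_of_memLp (hu : MemLp u 2 volume) (hu1 : IntegrableOn u (Ioi 0)) :
    MemX0Plus u := ⟨memLp_one_iff_integrable.2 hu1, hu.restrict _⟩

theorem memX0Minus_of_memLp (hu : MemLp u 2 volume) (hu1 : IntegrableOn u (Iio 0)) :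
    MemX0Minus u := ⟨memLp_one_iff_integrable.2 hu1, hu.restrict _⟩

theorem exists_extremalRep {q : Distr} (hq : q ∈ classQ) : ∃ uPlus uMinus v : ℝ → ℝ,
    (IsRightExtremalRep q uPlus ∧ ∀ u, IsRightExtremalRep q u → u =ᵐ[volume] uPlus) ∧
    (IsLeftExtremalRep q uMinus ∧ ∀ u, IsLeftExtremalRep q u → u =ᵐ[volume] uMinus) ∧
    (Continuous v ∧ v =ᵐ[volume] fun x => uMinus x - uPlus x) ∧
    MemX0Plus uPlus ∧ MemX0Minus uMinus ∧ 0 ≤ v 0 := by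
  obtain ⟨-, uP, uM, ⟨hP, hP1⟩, ⟨hM, hM1⟩, hqP, hqM⟩ := hq
  obtain ⟨c, hc0, -, hc'⟩ := exists_of_miura_eq hP hP1 hM (hqP.symm.trans hqM)
  refine ⟨uP, uM, fun x => c / (expInt uP x * expInt uM x),
    ⟨hqP ▸ isRightExtremalRep_miura hP hP1, fun u hu => (hqP ▸ hu).ae_eq hP hP1⟩,
    ⟨hqM ▸ isLeftExtremalRep_miura hM hM1, fun u hu => (hqM ▸ hu).ae_eq hM hM1⟩,
    ⟨continuous_div_expInt hP hM c, ?_⟩, memX0Plus_of_memLp hP hP1, memX0Minus_of_memLp hM hM1,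
    by simpa using hc0⟩
  filter_upwards [hc'] with x hx using hx.symm

/-! ### Construction of a potential from its data -/

/-- Representatives whose difference solves the linear equation `v' = -(u₊ + u₋) v` have the same
Miura transform. -/
theorem miura_eq_of_isPrimitive {v : ℝ → ℝ} (hP : MemLp uP 2 volume) (hM : MemLp uM 2 volume)
    (hv : IsPrimitive v fun x => -((uM x + uP x) * v x)) (huv : ∀ x, uM x - uP x = v x) :
    miura uP = miura uM := by
  suffices h : ∀ φ : TestFun, miura uP φ = miura uM φ by
    ext φ
    exact h φ
  intro φ
  rw [miura_apply hP, miura_apply hM, ← sub_eq_zero]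
  have hPl := hP.locallyIntegrable (by norm_num)
  have hMl := hM.locallyIntegrable (by norm_num)
  have hP2 : LocallyIntegrable fun x => uP x ^ 2 := hP.integrable_sq.locallyIntegrable
  have hM2 : LocallyIntegrable fun x => uM x ^ 2 := hM.integrable_sq.locallyIntegrable
  have i1 := integrable_continuous_mul hPl φ.continuous_deriv φ.hasCompactSupport_deriv
  have i2 := integrable_continuous_mul hMl φ.continuous_deriv φ.hasCompactSupport_deriv
  have i3 := integrable_continuous_mul hP2 φ.continuous φ.hasCompactSupport
  have i4 := integrable_continuous_mul hM2 φ.continuous φ.hasCompactSupport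
  have h := (isWeakDeriv_iff hv.isWeakDeriv.1 hv.1).1 hv.isWeakDeriv φ
  have e1 : ∫ x, deriv φ x * v x = (∫ x, deriv φ x * uM x) - ∫ x, deriv φ x * uP x := by
    rw [← integral_sub i2 i1]
    congr 1 with x
    rw [← huv]
    ring
  have e2 : ∫ x, φ x * -((uM x + uP x) * v x) =
      (∫ x, φ x * uP x ^ 2) - ∫ x, φ x * uM x ^ 2 := by
    rw [← integral_sub i3 i4]
    congr 1 with x
    rw [← huv]
    ring
  rw [e1, e2] at h
  rw [miuraForm, miuraForm]
  linarith

/-- The sign function, with value `-1` at `0`. -/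
noncomputable def halfLineSign (x : ℝ) : ℝ := if 0 < x then 1 else -1

theorem measurable_halfLineSign : Measurable halfLineSign :=
  Measurable.ite measurableSet_Ioi measurable_const measurable_const

theorem locallyIntegrable_halfLineSign : LocallyIntegrable halfLineSign := by
  refine (continuous_const (y := (1 : ℝ))).locallyIntegrable.mono
    measurable_halfLineSign.aestronglyMeasurable (ae_of_all _ fun x => ?_)
  rw [halfLineSign]
  split_ifs <;> simp

/-- Inversion is not `C¹` on all of `ℝ`, so `comp` does not apply. Instead `T · exp (-∫₀ˣ τ / T)`
has zero derivative, which writes `T⁻¹` as a constant times an exponential. -/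
theorem IsPrimitive.inv {T τ : ℝ → ℝ} (hT : IsPrimitive T τ) (h0 : ∀ x, 0 < T x) :
    IsPrimitive (fun x => (T x)⁻¹) fun x => -((T x)⁻¹ ^ 2 * τ x) := by
  have hTi : Continuous fun x => (T x)⁻¹ := hT.continuous.inv₀ fun x => (h0 x).ne'
  have hl : LocallyIntegrable fun x => (T x)⁻¹ * τ x := locallyIntegrable_continuous_mul hTi hT.1
  have hE := isPrimitive_inv_expInt hl
  have hc := fun x => (hT.mul hE).eq_of_ae_eq_zero (ae_of_all _ fun x => by
    have := (h0 x).ne'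
    simp only [Pi.zero_apply]
    field_simp
    ring) x
  have hinv : ∀ x, (T x)⁻¹ = (T 0)⁻¹ * (expInt (fun x => (T x)⁻¹ * τ x) x)⁻¹ := fun x => by
    have h := hc x
    rw [expInt_zero, inv_one, mul_one] at h
    rw [← h]
    rw [mul_inv, inv_inv, mul_assoc, mul_inv_cancel₀ (expInt_pos _ x).ne', mul_one]
  have h := hE.const_mul (T 0)⁻¹
  rw [← funext hinv] at h
  refine h.congr (ae_of_all _ fun x => ?_)
  simp only
  rw [mul_neg, ← mul_assoc, ← hinv]
  ring

/-- The glued-up difference `v` of the extremal Riccati representatives: a function with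
`v 0 = α`, `v' = -(2 w + v) v` on `(0, ∞)` and `v' = -(2 w - v) v` on `(-∞, 0)`. -/
theorem exists_riccati_difference {w : ℝ → ℝ} (hw : MemLp w 2 volume) (hw1 : Integrable w) {α : ℝ}
    (hα : 0 ≤ α) : ∃ v : ℝ → ℝ, v 0 = α ∧ MemLp v 2 volume ∧
      IsPrimitive v fun x => -((2 * w x + halfLineSign x * v x) * v x) := by
  set M := Real.exp (∫ t, ‖w t‖) with hM
  have hMpos : 0 < M := Real.exp_pos _
  have hwl := hw1.locallyIntegrable
  have hup : ∀ x, expInt w x ≤ M := fun x => by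
    have := expInt_le (s := univ) hw1.integrableOn (subset_univ (uIoc 0 x))
    rwa [setIntegral_univ] at this
  have hlow : ∀ x, (expInt w x)⁻¹ ≤ M := fun x => by
    have := expInt_le (u := fun t => -w t) (s := univ) hw1.neg.integrableOn
      (subset_univ (uIoc 0 x))
    rw [setIntegral_univ] at this
    simpa [expInt, Real.exp_neg, hM] using this
  have hcE := continuous_expInt hw
  have hcsq : Continuous fun x => 1 / expInt w x ^ 2 :=
    continuous_const.div (hcE.pow 2) fun t => (pow_pos (expInt_pos w t) 2).ne'
  set m := 1 / M ^ 2 with hm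
  have hm0 : 0 < m := by positivity
  have hmle : ∀ x, m ≤ 1 / expInt w x ^ 2 := fun x => by
    have := expInt_pos w x
    have := hup x
    rw [hm]
    gcongr
  have hJl : LocallyIntegrable fun x => 1 / expInt w x ^ 2 * halfLineSign x :=
    locallyIntegrable_continuous_mul hcsq locallyIntegrable_halfLineSign
  -- The sign makes `J = |∫₀ˣ (expInt w)⁻²|`, so `1 + α J` never vanishes and grows at least
  -- linearly on both sides when `α > 0`.
  set J := fun x => ∫ t in (0 : ℝ)..x, 1 / expInt w t ^ 2 * halfLineSign t with hJ
  have hJm : ∀ x, m * |x| ≤ J x := fun x => by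
    rcases le_total 0 x with hx | hx
    · have h1 : J x = ∫ t in (0 : ℝ)..x, 1 / expInt w t ^ 2 := by
        refine intervalIntegral.integral_congr_ae (ae_of_all _ fun t ht => ?_)
        rw [uIoc_of_le hx] at ht
        simp [halfLineSign, ht.1]
      rw [h1, abs_of_nonneg hx]
      have := intervalIntegral.integral_mono_on hx (f := fun _ => m)
        (continuous_const.intervalIntegrable (μ := volume) _ _) (hcsq.intervalIntegrable _ _)
        fun t _ => hmle t
      simpa [mul_comm] using this
    · have h1 : J x = ∫ t in x..(0 : ℝ), 1 / expInt w t ^ 2 := by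
        rw [hJ, intervalIntegral.integral_symm, ← intervalIntegral.integral_neg]
        refine intervalIntegral.integral_congr_ae (ae_of_all _ fun t ht => ?_)
        rw [uIoc_of_ge hx] at ht
        simp [halfLineSign, not_lt.2 ht.2]
      rw [h1, abs_of_nonpos hx]
      have := intervalIntegral.integral_mono_on hx (f := fun _ => m)
        (continuous_const.intervalIntegrable (μ := volume) _ _) (hcsq.intervalIntegrable _ _)
        fun t _ => hmle t
      simpa [mul_comm] using this
  have hJ0 : ∀ x, 0 ≤ J x := fun x => (by positivity : 0 ≤ m * |x|).trans (hJm x)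
  have hT0 : ∀ x, 0 < 1 + α * J x := fun x => by have := hJ0 x; positivity
  have hTp : IsPrimitive (fun x => 1 + α * J x)
      fun x => α * (1 / expInt w x ^ 2 * halfLineSign x) := by
    have := isPrimitive_integral (hJl.smul α) 1
    simp only [Pi.smul_apply, smul_eq_mul, intervalIntegral.integral_const_mul] at this
    exact this
  have hEi := isPrimitive_inv_expInt hwl
  -- The Bernoulli solution `v = α (expInt w)⁻² / (1 + α J)`.
  have hvp := ((hEi.mul hEi).mul (hTp.inv hT0)).const_mul α
  refine ⟨_, ?_, ?_, hvp.congr (ae_of_all _ fun x => ?_)⟩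
  · simp [hJ]
  -- For `α = 0` the denominator of `C` below would vanish, but then `v = 0`.
  · rcases hα.eq_or_lt with rfl | hα0
    · simp
    set C := α * M ^ 2 / min 1 (α * m) with hC
    have hk : 0 < min 1 (α * m) := lt_min one_pos (by positivity)
    have hg : MemLp (fun x : ℝ => C * (1 + |x|)⁻¹) 2 volume := by
      refine MemLp.const_mul ?_ C
      have hgc : Continuous fun x : ℝ => (1 + |x|)⁻¹ :=
        (continuous_const.add continuous_abs).inv₀ fun x =>
          (by positivity : (1 : ℝ) + |x| ≠ 0)
      refine (memLp_two_iff_integrable_sq hgc.aestronglyMeasurable).2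
        (integrable_inv_one_add_sq.mono' (hgc.pow 2).aestronglyMeasurable
        (ae_of_all _ fun x => ?_))
      rw [Real.norm_of_nonneg (by positivity), inv_pow]
      gcongr
      nlinarith [abs_nonneg x, sq_abs x]
    refine hg.mono' hvp.continuous.aestronglyMeasurable (ae_of_all _ fun x => ?_)
    have hE := expInt_pos w x
    have hT := hT0 x
    rw [Real.norm_of_nonneg (mul_nonneg hα (mul_nonneg (by positivity) (inv_nonneg.2 hT.le)))]
    have h1 : min 1 (α * m) * (1 + |x|) ≤ 1 + α * J x := by
      have a1 := mul_le_mul_of_nonneg_right (min_le_right 1 (α * m)) (abs_nonneg x)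
      have a2 := min_le_left 1 (α * m)
      have a3 := mul_le_mul_of_nonneg_left (hJm x) hα
      linarith
    have h2 : (expInt w x)⁻¹ * (expInt w x)⁻¹ ≤ M ^ 2 := by
      rw [sq]
      exact mul_le_mul (hlow x) (hlow x) (by positivity) hMpos.le
    have h3 : (1 + α * J x)⁻¹ ≤ (min 1 (α * m) * (1 + |x|))⁻¹ :=
      inv_anti₀ (by positivity) h1
    calc α * ((expInt w x)⁻¹ * (expInt w x)⁻¹ * (1 + α * J x)⁻¹)
        ≤ α * (M ^ 2 * (min 1 (α * m) * (1 + |x|))⁻¹) := by gcongr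
      _ = C * (1 + |x|)⁻¹ := by rw [hC, mul_inv]; ring
  · have := (expInt_pos w x).ne'
    have := (hT0 x).ne'
    field_simp
    ring

theorem exists_hasExtremalData {wPlus wMinus : ℝ → ℝ} {α : ℝ} (hwP : MemX0Plus wPlus)
    (hwM : MemX0Minus wMinus) (hα : 0 ≤ α) :
    ∃ q ∈ classQ, HasExtremalData q wPlus wMinus α := by
  set w : ℝ → ℝ := (Ioi 0).indicator wPlus + (Iio 0).indicator wMinus with hw
  have hw2 : MemLp w 2 volume := ((memLp_indicator_iff_restrict measurableSet_Ioi).2 hwP.2).add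
    ((memLp_indicator_iff_restrict measurableSet_Iio).2 hwM.2)
  have hw1 : Integrable w := memLp_one_iff_integrable.1
    (((memLp_indicator_iff_restrict measurableSet_Ioi).2 hwP.1).add
    ((memLp_indicator_iff_restrict measurableSet_Iio).2 hwM.1))
  obtain ⟨v, hv0, hv2, hv⟩ := exists_riccati_difference hw2 hw1 hα
  -- On `(0, ∞)` the pair `(u₊, u₋)` is `(w, w + v)`, on `(-∞, 0)` it is `(w - v, w)`. Hence `u₊ +
  -- u₋ = 2 w ± v`, as in the equation for `v`.
  set uM : ℝ → ℝ := fun x => w x + (Ioi 0).indicator v x with huM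
  set uP : ℝ → ℝ := fun x => uM x - v x with huP
  have hM2 : MemLp uM 2 volume := hw2.add (hv2.indicator measurableSet_Ioi)
  have hP2 : MemLp uP 2 volume := hM2.sub hv2
  have hPw : ∀ x ∈ Ioi (0 : ℝ), uP x = wPlus x := fun x hx => by
    have : ¬ x < 0 := not_lt.2 (le_of_lt hx)
    simp [huP, huM, hw, mem_Ioi.1 hx, this]
  have hMw : ∀ x ∈ Iio (0 : ℝ), uM x = wMinus x := fun x hx => by
    have : ¬ 0 < x := not_lt.2 (le_of_lt hx)
    simp [huM, hw, mem_Iio.1 hx, this]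
  have hP1 : IntegrableOn uP (Ioi 0) :=
    (integrableOn_congr_fun hPw measurableSet_Ioi).2 (memLp_one_iff_integrable.1 hwP.1)
  have hM1 : IntegrableOn uM (Iio 0) :=
    (integrableOn_congr_fun hMw measurableSet_Iio).2 (memLp_one_iff_integrable.1 hwM.1)
  have hvp : IsPrimitive v fun x => -((uM x + uP x) * v x) := by
    refine hv.congr (ae_of_all _ fun x => ?_)
    by_cases hx : 0 < x
    · simp only [huP, huM, halfLineSign, indicator_of_mem (mem_Ioi.2 hx), if_pos hx]
      ring
    · simp only [huP, huM, halfLineSign, indicator_of_notMem (notMem_Ioi.2 (not_lt.1 hx)),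
        if_neg hx]
      ring
  have hq : miura uP = miura uM := miura_eq_of_isPrimitive hP2 hM2 hvp fun x => by simp [huP]
  refine ⟨miura uP, ⟨memHNegOne_miura hP2, uP, uM, ⟨hP2, hP1⟩, ⟨hM2, hM1⟩, rfl, hq⟩,
    uP, uM, v, isRightExtremalRep_miura hP2 hP1, hq ▸ isLeftExtremalRep_miura hM2 hM1,
    hv.continuous, ae_of_all _ fun x => by simp [huP], ?_, ?_, hv0⟩
  · filter_upwards [ae_restrict_mem measurableSet_Ioi] with x hx using hPw x hx
  · filter_upwards [ae_restrict_mem measurableSet_Iio] with x hx using hMw x hx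

end

end MiuraPotential

theorem lemma2p3 :
    (∀ (wPlus wMinus : ℝ → ℝ) (α : ℝ),
      MiuraPotential.MemX0Plus wPlus → MiuraPotential.MemX0Minus wMinus → 0 ≤ α →
        ∃! q : MiuraPotential.Distr,
          q ∈ MiuraPotential.classQ ∧ MiuraPotential.HasExtremalData q wPlus wMinus α) ∧
    (∀ q ∈ MiuraPotential.classQ, ∃ uPlus uMinus v : ℝ → ℝ,
      (MiuraPotential.IsRightExtremalRep q uPlus ∧
        ∀ u, MiuraPotential.IsRightExtremalRep q u → u =ᵐ[volume] uPlus) ∧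
      (MiuraPotential.IsLeftExtremalRep q uMinus ∧
        ∀ u, MiuraPotential.IsLeftExtremalRep q u → u =ᵐ[volume] uMinus) ∧
      (Continuous v ∧ v =ᵐ[volume] fun x => uMinus x - uPlus x) ∧
      MiuraPotential.MemX0Plus uPlus ∧ MiuraPotential.MemX0Minus uMinus ∧ 0 ≤ v 0) := by

  refine ⟨fun wPlus wMinus α hP hM hα => ?_, fun q hq => MiuraPotential.exists_extremalRep hq⟩
  obtain ⟨q, hq, hqd⟩ := MiuraPotential.exists_hasExtremalData hP hM hα
  exact ⟨q, ⟨hq, hqd⟩, fun r hr => hr.2.unique hr.1 hq hqd⟩
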